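/- Let $d\ge 1$ and let $\Omega=\prod_{k=1}^d(a_k,b_k)\subset\mathbb{R}^d$ be a bounded open box (an interval if $d=1$, an axis-aligned rectangle if $d=2$). A partition of $\Omega$ consists of finitely many pairwise disjoint nonempty open axis-aligned boxes $\Omega_1,\dots,\Omega_I\subset\Omega$ with $\overline\Omega=\bigcup_i\overline{\Omega_i}$; its set of interior interfaces is $\Gamma=\Omega\cap\bigcup_{i\ne j}(\partial\Omega_i\cap\partial\Omega_j)$, equipped with the $(d-1)$-dimensional surface measure $dS$ (counting measure if $d=1$, length if $d=2$). Let $p$ be piecewise constant, $p=p_i\in(0,\infty)$ on $\Omega_i$, and $\min p=\min_i p_i$. Let $H^1_0(\Omega)$ be the closure of $C_c^\infty(\Omega)$ in $H^1(\Omega)$, with $\|u\|_{H^1_0}=\|\nabla u\|_{L^2(\Omega)}$. For a field $\sigma$ with $\sigma|_{\Omega_i}\in H(\mathrm{div},\Omega_i)$ for all $i$, let $\operatorname{div}\sigma\in L^2(\Omega)$ denote the piecewise weak divergence, and write $[\sigma\cdot\mathbf n]=g\in L^2(\Gamma)$ if the sum over the subdomains of the outward normal traces of $\sigma$ is represented by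 $g$: $$\sum_i\int_{\Omega_i}\big(\sigma\cdot\nabla\varphi+(\operatorname{div}\sigma)\,\varphi\big)\,dx=\int_\Gamma g\,\varphi\,dS\qquad\text{for all }\varphi\in C_c^\infty(\Omega).$$ Let $$\mathbb X^p=\{u\in H^1_0(\Omega):\ (p\nabla u)|_{\Omega_i}\in H(\mathrm{div},\Omega_i)\text{ for all }i,\ [p\nabla u\cdot\mathbf n]\in L^2(\Gamma)\},$$ and, for $\Theta>0$ and $u\in\mathbb X^p$, $$\|u\|_{\mathbb X^p}=\Big(\|\operatorname{div}(p\nabla u)\|_{L^2(\Omega)}^2+\Theta\,\|[p\nabla u\cdot\mathbf n]\|_{L^2(\Gamma)}^2\Big)^{1/2},$$ $$\|u\|_g=\Big(\|u\|_{H^1_0}^2+\sum_i\|\operatorname{div}(p\nabla u)\|_{L^2(\Omega_i)}^2+\|[p\nabla u\cdot\mathbf n]\|_{L^2(\Gamma)}^2\Big)^{1/2}.$$ Theorem. Fix $\Omega$. For every $\Theta>0$ and every interface set $\Gamma$ there is a constant $C>0$, depending only on $\Omega$, $\Theta$ and $\Gamma$, such that for every partition of $\Omega$ with interface set $\Gamma$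 and every $p$ as above: 1. For all $u\in\mathbb X^p$, $$\|u\|_{H^1_0}\le\frac{C}{\min p}\sqrt{\|\operatorname{div}(p\nabla u)\|_{L^2(\Omega)}^2+\Theta\,\|[p\nabla u\cdot\mathbf n]\|_{L^2(\Gamma)}^2}.$$ 2. $\|\cdot\|_{\mathbb X^p}$ and $\|\cdot\|_g$ are norms on $\mathbb X^p$, and they are equivalent: there are $c_1,c_2>0$ (which may depend on $p$, the partition and $\Theta$) with $c_1\|u\|_g\le\|u\|_{\mathbb X^p}\le c_2\|u\|_g$ for all $u\in\mathbb X^p$. 3. If $\ell\in L^2(\Omega)$ and $\mathfrak u\in H^1_0(\Omega)$ satisfies $\int_\Omega p\nabla\mathfrak u\cdot\nabla v\,dx=\int_\Omega\ell v\,dx$ for all $v\in H^1_0(\Omega)$, then $\mathfrak u\in\mathbb X^p$ and, for all $u\in\mathbb X^p$, $$\|u-\mathfrak u\|_{H^1_0}\le\frac{C}{\min p}\,\|u-\mathfrak u\|_{\mathbb X^p},\qquad \|u-\mathfrak u\|_{\mathbb X^p}=\sqrt{\|\operatorname{div}(p\nabla u)+\ell\|_{L^2(\Omega)}^2+\Theta\,\|[p\nabla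 u\cdot\mathbf n]\|_{L^2(\Gamma)}^2}.$$ -/

import Mathlib

open MeasureTheory Filter Topology TopologicalSpace
open scoped ENNReal ContDiff Distributions InnerProductSpace

namespace Transmission

noncomputable section

/-! ### Test functions, weak gradient, `H¹₀` -/

/-- The Euclidean space `ℝᵈ`. -/
abbrev Space (d : ℕ) := EuclideanSpace ℝ (Fin d)

/-- `L²(U)`. -/
abbrev L2 {d : ℕ} (U : Opens (Space d)) := Lp ℝ 2 (volume.restrict (U : Set (Space d)))

/-- `L²(U)ᵈ`. -/
abbrev L2Vec {d : ℕ} (U : Opens (Space d)) := Lp (Space d) 2 (volume.restrict (U : Set (Space d)))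

/-- `G` is the weak gradient of `u` on `U`:
`∫_U u ∂ₖφ = -∫_U Gₖ φ` for all `φ ∈ C_c^∞(U)` and all `k`. -/
def IsWeakGrad {d : ℕ} (U : Opens (Space d)) (u : L2 U) (G : L2Vec U) : Prop :=
  ∀ φ : 𝓓(U, ℝ), ∀ k : Fin d,
    ∫ x in (U : Set (Space d)), u x * (gradient φ x) k =
      -∫ x in (U : Set (Space d)), (G x) k * φ x

open Classical in
/-- The weak gradient `∇u ∈ L²(U)ᵈ` (it is unique; the value is `0` if there is none). -/
def weakGrad {d : ℕ} (U : Opens (Space d)) (u : L2 U) : L2Vec U :=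
  if h : ∃ G, IsWeakGrad U u G then h.choose else 0

/-- `σ : ℝᵈ → ℝᵈ` has weak divergence `f` on `U`:
`∫_U σ · ∇φ = -∫_U f φ` for all `φ ∈ C_c^∞(U)`. -/
def IsWeakDiv {d : ℕ} (U : Opens (Space d)) (σ : Space d → Space d) (f : L2 U) : Prop :=
  ∀ φ : 𝓓(U, ℝ),
    ∫ x in (U : Set (Space d)), inner ℝ (σ x) (gradient φ x) =
      -∫ x in (U : Set (Space d)), f x * φ x

/-- `σ|_U ∈ H(div, U)`. -/
def MemHdiv {d : ℕ} (U : Opens (Space d)) (σ : Space d → Space d) : Prop :=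
  MemLp σ 2 (volume.restrict (U : Set (Space d))) ∧ ∃ f : L2 U, IsWeakDiv U σ f

open Classical in
/-- The weak divergence `div σ ∈ L²(U)` (it is unique; the value is `0` if there is none). -/
def weakDiv {d : ℕ} (U : Opens (Space d)) (σ : Space d → Space d) : L2 U :=
  if h : ∃ f, IsWeakDiv U σ f then h.choose else 0

/-- The normal trace `σ · n` on `∂U` of a field `σ ∈ H(div, U)`, `n` being the outward unit normal,
as a functional of `φ`: `⟨σ · n, φ⟩_{∂U} = ∫_U (σ · ∇φ + (div σ) φ)`. -/
def normalTrace {d : ℕ} (U : Opens (Space d)) (σ : Space d → Space d) (φ : Space d → ℝ) : ℝ :=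
  ∫ x in (U : Set (Space d)), (inner ℝ (σ x) (gradient φ x) + weakDiv U σ x * φ x)

section Helpers

variable {d : ℕ} {U : Opens (Space d)}

lemma continuous_gradient (φ : 𝓓(U, ℝ)) : Continuous (gradient (φ : Space d → ℝ)) := by
  have h : Continuous (fderiv ℝ (φ : Space d → ℝ)) :=
    φ.contDiff.continuous_fderiv (by simp)
  exact (InnerProductSpace.toDual ℝ (Space d)).symm.continuous.comp h

lemma hasCompactSupport_gradient (φ : 𝓓(U, ℝ)) :
    HasCompactSupport (gradient (φ : Space d → ℝ)) := by
  have h : HasCompactSupport (fderiv ℝ (φ : Space d → ℝ)) := φ.hasCompactSupport.fderiv ℝ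
  exact h.comp_left (g := (InnerProductSpace.toDual ℝ (Space d)).symm) (map_zero _)

lemma differentiable_test (φ : 𝓓(U, ℝ)) : Differentiable ℝ (φ : Space d → ℝ) :=
  φ.contDiff.differentiable (by simp)

lemma memLp_test (φ : 𝓓(U, ℝ)) (μ : Measure (Space d)) [IsFiniteMeasureOnCompacts μ] :
    MemLp (φ : Space d → ℝ) 2 μ :=
  φ.continuous.memLp_of_hasCompactSupport φ.hasCompactSupport

lemma memLp_gradient (φ : 𝓓(U, ℝ)) (μ : Measure (Space d)) [IsFiniteMeasureOnCompacts μ] :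
    MemLp (gradient (φ : Space d → ℝ)) 2 μ :=
  (continuous_gradient φ).memLp_of_hasCompactSupport (hasCompactSupport_gradient φ)

lemma gradient_add_test (φ ψ : 𝓓(U, ℝ)) (x : Space d) :
    gradient (φ + ψ : 𝓓(U, ℝ)) x = gradient φ x + gradient ψ x := by
  have : ((φ + ψ : 𝓓(U, ℝ)) : Space d → ℝ) = (φ : Space d → ℝ) + ψ := by
    ext; simp
  rw [gradient, this, fderiv_add (differentiable_test φ x) (differentiable_test ψ x), map_add]
  rfl

lemma gradient_smul_test (c : ℝ) (φ : 𝓓(U, ℝ)) (x : Space d) :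
    gradient (c • φ : 𝓓(U, ℝ)) x = c • gradient φ x := by
  have : ((c • φ : 𝓓(U, ℝ)) : Space d → ℝ) = c • (φ : Space d → ℝ) := by
    ext; simp
  rw [gradient, this, fderiv_const_smul (differentiable_test φ x)]
  simp [gradient]

/-- Fundamental lemma of the calculus of variations. -/
lemma eq_zero_of_forall_test (h : L2 U)
    (H : ∀ φ : 𝓓(U, ℝ), ∫ x in (U : Set (Space d)), h x * φ x = 0) : h = 0 := by
  have hloc : LocallyIntegrableOn h (U : Set (Space d)) volume := by
    have h1 : LocallyIntegrable h (volume.restrict (U : Set (Space d))) :=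
      (Lp.memLp h).locallyIntegrable (by norm_num)
    exact locallyIntegrableOn_of_locallyIntegrable_restrict h1
  have key := U.isOpen.ae_eq_zero_of_integral_contDiff_smul_eq_zero hloc (by
    intro g hg hc hs
    have := H ⟨g, hg, hc, hs⟩
    rw [← setIntegral_eq_integral_of_forall_compl_eq_zero (s := (U : Set (Space d)))
      (fun x hx => by
        rw [image_eq_zero_of_notMem_tsupport (fun h => hx (hs h)), zero_smul])]
    simpa [mul_comm] using this)
  rw [Lp.eq_zero_iff_ae_eq_zero, EventuallyEq, ae_restrict_iff' U.isOpen.measurableSet]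
  exact key

lemma integrable_mul {μ : Measure (Space d)} {f g : Space d → ℝ} (hf : MemLp f 2 μ)
    (hg : MemLp g 2 μ) : Integrable (fun x => f x * g x) μ :=
  hf.integrable_mul hg

lemma memLp_coord {μ : Measure (Space d)} {f : Space d → Space d} (hf : MemLp f 2 μ)
    (k : Fin d) : MemLp (fun x => f x k) 2 μ :=
  (EuclideanSpace.proj (𝕜 := ℝ) k : Space d →L[ℝ] ℝ).comp_memLp' hf

lemma integrable_inner' {μ : Measure (Space d)} {f g : Space d → Space d} (hf : MemLp f 2 μ)
    (hg : MemLp g 2 μ) : Integrable (fun x => (inner ℝ (f x) (g x) : ℝ)) μ :=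
  (L2.integrable_inner (𝕜 := ℝ) (hf.toLp f) (hg.toLp g)).congr (by
    filter_upwards [hf.coeFn_toLp, hg.coeFn_toLp] with x h1 h2
    rw [h1, h2])

lemma IsWeakGrad.unique {u : L2 U} {G G' : L2Vec U} (h : IsWeakGrad U u G)
    (h' : IsWeakGrad U u G') : G = G' := by
  have key : ∀ k : Fin d, ∀ᵐ x ∂(volume.restrict (U : Set (Space d))), G x k = G' x k := by
    intro k
    have m1 := memLp_coord (Lp.memLp G) k
    have m2 := memLp_coord (Lp.memLp G') k
    have := eq_zero_of_forall_test (U := U) (m1.toLp _ - m2.toLp _) (by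
      intro φ
      have e1 := h φ k
      have e2 := h' φ k
      have e3 : ∫ x in (U : Set (Space d)), (G x k * φ x - G' x k * φ x) = 0 := by
        rw [integral_sub (integrable_mul m1 (memLp_test φ _))
          (integrable_mul m2 (memLp_test φ _))]
        linarith
      rw [← e3]
      refine integral_congr_ae ?_
      filter_upwards [Lp.coeFn_sub (m1.toLp _) (m2.toLp _), m1.coeFn_toLp, m2.coeFn_toLp]
        with x h1 h2 h3
      rw [h1, Pi.sub_apply, h2, h3, sub_mul])
    rw [sub_eq_zero] at this
    exact (MemLp.toLp_eq_toLp_iff m1 m2).1 this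
  refine Lp.ext ?_
  filter_upwards [ae_all_iff.2 key] with x hx
  ext k
  exact hx k

lemma IsWeakGrad.add {u v : L2 U} {G H : L2Vec U} (hu : IsWeakGrad U u G)
    (hv : IsWeakGrad U v H) : IsWeakGrad U (u + v) (G + H) := by
  intro φ k
  have g := memLp_coord (memLp_gradient φ (volume.restrict (U : Set (Space d)))) k
  have f := memLp_test φ (volume.restrict (U : Set (Space d)))
  calc ∫ x in (U : Set (Space d)), (u + v : L2 U) x * (gradient φ x) k
      = ∫ x in (U : Set (Space d)), (u x * (gradient φ x) k + v x * (gradient φ x) k) := by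
        refine integral_congr_ae ?_
        filter_upwards [Lp.coeFn_add u v] with x hx
        rw [hx, Pi.add_apply, add_mul]
    _ = -∫ x in (U : Set (Space d)), ((G x) k * φ x + (H x) k * φ x) := by
        rw [integral_add (integrable_mul (Lp.memLp u) g) (integrable_mul (Lp.memLp v) g),
          integral_add (integrable_mul (memLp_coord (Lp.memLp G) k) f)
            (integrable_mul (memLp_coord (Lp.memLp H) k) f), hu φ k, hv φ k]
        ring
    _ = _ := by
        congr 1
        refine integral_congr_ae ?_
        filter_upwards [Lp.coeFn_add G H] with x hx
        rw [hx, Pi.add_apply, PiLp.add_apply, add_mul]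

lemma IsWeakGrad.smul (c : ℝ) {u : L2 U} {G : L2Vec U} (hu : IsWeakGrad U u G) :
    IsWeakGrad U (c • u) (c • G) := by
  intro φ k
  calc ∫ x in (U : Set (Space d)), (c • u : L2 U) x * (gradient φ x) k
      = ∫ x in (U : Set (Space d)), c * (u x * (gradient φ x) k) := by
        refine integral_congr_ae ?_
        filter_upwards [Lp.coeFn_smul c u] with x hx
        rw [hx, Pi.smul_apply, smul_eq_mul, mul_assoc]
    _ = -∫ x in (U : Set (Space d)), c * ((G x) k * φ x) := by
        rw [integral_const_mul, integral_const_mul, hu φ k]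
        ring
    _ = _ := by
        congr 1
        refine integral_congr_ae ?_
        filter_upwards [Lp.coeFn_smul c G] with x hx
        rw [hx, Pi.smul_apply, PiLp.smul_apply, smul_eq_mul, mul_assoc]

lemma isWeakGrad_zero : IsWeakGrad U 0 0 := by
  intro φ k
  have h1 : ∫ x in (U : Set (Space d)), (0 : L2 U) x * (gradient φ x) k = 0 := by
    refine integral_eq_zero_of_ae ?_
    filter_upwards [Lp.coeFn_zero ℝ 2 (volume.restrict (U : Set (Space d)))] with x hx
    rw [hx]; simp
  have h2 : ∫ x in (U : Set (Space d)), ((0 : L2Vec U) x) k * φ x = 0 := by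
    refine integral_eq_zero_of_ae ?_
    filter_upwards [Lp.coeFn_zero (Space d) 2 (volume.restrict (U : Set (Space d)))] with x hx
    rw [hx]; simp
  rw [h1, h2, neg_zero]

lemma weakGrad_spec {u : L2 U} (h : ∃ G, IsWeakGrad U u G) : IsWeakGrad U u (weakGrad U u) := by
  rw [weakGrad, dif_pos h]
  exact h.choose_spec

lemma IsWeakGrad.weakGrad_eq {u : L2 U} {G : L2Vec U} (h : IsWeakGrad U u G) :
    weakGrad U u = G :=
  (weakGrad_spec ⟨G, h⟩).unique h

lemma IsWeakDiv.unique {σ : Space d → Space d} {f f' : L2 U} (h : IsWeakDiv U σ f)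
    (h' : IsWeakDiv U σ f') : f = f' := by
  rw [← sub_eq_zero]
  refine eq_zero_of_forall_test _ fun φ => ?_
  have m := memLp_test φ (volume.restrict (U : Set (Space d)))
  have e1 := h φ
  have e2 := h' φ
  have e3 : ∫ x in (U : Set (Space d)), (f x * φ x - f' x * φ x) = 0 := by
    rw [integral_sub (integrable_mul (Lp.memLp f) m) (integrable_mul (Lp.memLp f') m)]
    linarith
  rw [← e3]
  refine integral_congr_ae ?_
  filter_upwards [Lp.coeFn_sub f f'] with x hx
  rw [hx, Pi.sub_apply, sub_mul]

lemma IsWeakDiv.congr {σ τ : Space d → Space d} {f : L2 U} (h : IsWeakDiv U σ f)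
    (e : σ =ᵐ[volume.restrict (U : Set (Space d))] τ) : IsWeakDiv U τ f := by
  intro φ
  rw [← h φ]
  refine integral_congr_ae ?_
  filter_upwards [e] with x hx
  rw [hx]

lemma IsWeakDiv.add {σ τ : Space d → Space d} {f g : L2 U}
    (mσ : MemLp σ 2 (volume.restrict (U : Set (Space d))))
    (mτ : MemLp τ 2 (volume.restrict (U : Set (Space d))))
    (h : IsWeakDiv U σ f) (h' : IsWeakDiv U τ g) : IsWeakDiv U (σ + τ) (f + g) := by
  intro φ
  have m := memLp_test φ (volume.restrict (U : Set (Space d)))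
  have m' := memLp_gradient φ (volume.restrict (U : Set (Space d)))
  simp only [Pi.add_apply, inner_add_left]
  rw [integral_add (integrable_inner' mσ m') (integrable_inner' mτ m'), h φ, h' φ, ← neg_add,
    ← integral_add (integrable_mul (Lp.memLp f) m) (integrable_mul (Lp.memLp g) m)]
  congr 1
  refine integral_congr_ae ?_
  filter_upwards [Lp.coeFn_add f g] with x hx
  rw [hx, Pi.add_apply, add_mul]

lemma IsWeakDiv.smul (c : ℝ) {σ : Space d → Space d} {f : L2 U} (h : IsWeakDiv U σ f) :
    IsWeakDiv U (c • σ) (c • f) := by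
  intro φ
  simp only [Pi.smul_apply, real_inner_smul_left]
  rw [integral_const_mul, h φ, mul_neg, ← integral_const_mul]
  congr 1
  refine integral_congr_ae ?_
  filter_upwards [Lp.coeFn_smul c f] with x hx
  rw [hx, Pi.smul_apply, smul_eq_mul, mul_assoc]

lemma MemHdiv.isWeakDiv {σ : Space d → Space d} (h : MemHdiv U σ) :
    IsWeakDiv U σ (weakDiv U σ) := by
  rw [weakDiv, dif_pos h.2]
  exact h.2.choose_spec

lemma IsWeakDiv.weakDiv_eq {σ : Space d → Space d} {f : L2 U} (h : IsWeakDiv U σ f) :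
    weakDiv U σ = f := by
  have h' : ∃ f, IsWeakDiv U σ f := ⟨f, h⟩
  rw [weakDiv, dif_pos h']
  exact h'.choose_spec.unique h

lemma MemHdiv.congr {σ τ : Space d → Space d} (h : MemHdiv U σ)
    (e : σ =ᵐ[volume.restrict (U : Set (Space d))] τ) : MemHdiv U τ :=
  ⟨h.1.ae_eq e, _, h.isWeakDiv.congr e⟩

lemma MemHdiv.add {σ τ : Space d → Space d} (h : MemHdiv U σ) (h' : MemHdiv U τ) :
    MemHdiv U (σ + τ) :=
  ⟨h.1.add h'.1, _, h.isWeakDiv.add h.1 h'.1 h'.isWeakDiv⟩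

lemma MemHdiv.smul (c : ℝ) {σ : Space d → Space d} (h : MemHdiv U σ) : MemHdiv U (c • σ) :=
  ⟨h.1.const_smul c, _, h.isWeakDiv.smul c⟩

lemma normalTrace_congr {σ τ : Space d → Space d} (h : MemHdiv U σ)
    (e : σ =ᵐ[volume.restrict (U : Set (Space d))] τ) (φ : Space d → ℝ) :
    normalTrace U σ φ = normalTrace U τ φ := by
  have : weakDiv U τ = weakDiv U σ := (h.isWeakDiv.congr e).weakDiv_eq
  rw [normalTrace, normalTrace, this]
  refine integral_congr_ae ?_
  filter_upwards [e] with x hx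
  rw [hx]

lemma normalTrace_add {σ τ : Space d → Space d} (h : MemHdiv U σ) (h' : MemHdiv U τ)
    {V : Opens (Space d)} (φ : 𝓓(V, ℝ)) :
    normalTrace U (σ + τ) φ = normalTrace U σ φ + normalTrace U τ φ := by
  have m := memLp_test φ (volume.restrict (U : Set (Space d)))
  have m' := memLp_gradient φ (volume.restrict (U : Set (Space d)))
  have e : weakDiv U (σ + τ) = weakDiv U σ + weakDiv U τ :=
    (h.isWeakDiv.add h.1 h'.1 h'.isWeakDiv).weakDiv_eq
  have i1 : Integrable (fun x => inner ℝ (σ x) (gradient φ x) + weakDiv U σ x * φ x)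
      (volume.restrict (U : Set (Space d))) :=
    (integrable_inner' h.1 m').add (integrable_mul (Lp.memLp _) m)
  have i2 : Integrable (fun x => inner ℝ (τ x) (gradient φ x) + weakDiv U τ x * φ x)
      (volume.restrict (U : Set (Space d))) :=
    (integrable_inner' h'.1 m').add (integrable_mul (Lp.memLp _) m)
  rw [normalTrace, normalTrace, normalTrace, ← integral_add i1 i2, e]
  refine integral_congr_ae ?_
  filter_upwards [Lp.coeFn_add (weakDiv U σ) (weakDiv U τ)] with x hx
  rw [hx]
  simp only [Pi.add_apply, inner_add_left]
  ring

lemma normalTrace_smul (c : ℝ) {σ : Space d → Space d} (h : MemHdiv U σ) (φ : Space d → ℝ) :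
    normalTrace U (c • σ) φ = c * normalTrace U σ φ := by
  have e : weakDiv U (c • σ) = c • weakDiv U σ := (h.isWeakDiv.smul c).weakDiv_eq
  rw [normalTrace, normalTrace, ← integral_const_mul, e]
  refine integral_congr_ae ?_
  filter_upwards [Lp.coeFn_smul c (weakDiv U σ)] with x hx
  rw [hx]
  simp only [Pi.smul_apply, real_inner_smul_left, smul_eq_mul]
  ring

end Helpers

/-- `H¹₀(U)`: the `u ∈ L²(U)` with weak gradient in `L²(U)ᵈ` that are limits in the `H¹` norm of
functions in `C_c^∞(U)`. -/
def H10 {d : ℕ} (U : Opens (Space d)) : Submodule ℝ (L2 U) where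
  carrier := {u | (∃ G, IsWeakGrad U u G) ∧ ∃ φ : ℕ → 𝓓(U, ℝ),
    Tendsto (fun n => eLpNorm (fun x => φ n x - u x) 2 (volume.restrict (U : Set (Space d))))
      atTop (𝓝 0) ∧
    Tendsto (fun n => eLpNorm (fun x => gradient (φ n) x - weakGrad U u x) 2
      (volume.restrict (U : Set (Space d)))) atTop (𝓝 0)}
  zero_mem' := by
    refine ⟨⟨0, isWeakGrad_zero⟩, fun _ => 0, ?_, ?_⟩
    · refine tendsto_const_nhds.congr fun n => ?_
      symm
      rw [← eLpNorm_zero (α := Space d) (ε := ℝ) (p := 2)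
        (μ := volume.restrict (U : Set (Space d)))]
      refine eLpNorm_congr_ae ?_
      filter_upwards [Lp.coeFn_zero ℝ 2 (volume.restrict (U : Set (Space d)))] with x hx
      rw [hx]; simp
    · refine tendsto_const_nhds.congr fun n => ?_
      symm
      rw [← eLpNorm_zero (α := Space d) (ε := Space d) (p := 2)
        (μ := volume.restrict (U : Set (Space d))), isWeakGrad_zero.weakGrad_eq]
      refine eLpNorm_congr_ae ?_
      filter_upwards [Lp.coeFn_zero (Space d) 2 (volume.restrict (U : Set (Space d)))] with x hx
      have := gradient_smul_test (U := U) 0 0 x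
      rw [zero_smul, zero_smul] at this
      rw [hx]
      simpa using this
  add_mem' := by
    rintro u v ⟨hu, φ, h1, h2⟩ ⟨hv, ψ, h3, h4⟩
    have hG := (weakGrad_spec hu).add (weakGrad_spec hv)
    refine ⟨⟨_, hG⟩, fun n => φ n + ψ n, ?_, ?_⟩
    · refine tendsto_of_tendsto_of_tendsto_of_le_of_le tendsto_const_nhds
        (by simpa using h1.add h3) (fun _ => zero_le) fun n => ?_
      refine le_trans (eLpNorm_congr_ae ?_).le (eLpNorm_add_le
        ((memLp_test (φ n) _).sub (Lp.memLp u)).1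
        ((memLp_test (ψ n) _).sub (Lp.memLp v)).1 (by norm_num))
      filter_upwards [Lp.coeFn_add u v] with x hx
      have e : (φ n + ψ n : 𝓓(U, ℝ)) x = φ n x + ψ n x := by simp
      simp only [hx, Pi.add_apply, e]
      ring
    · refine tendsto_of_tendsto_of_tendsto_of_le_of_le tendsto_const_nhds
        (by simpa using h2.add h4) (fun _ => zero_le) fun n => ?_
      rw [hG.weakGrad_eq]
      refine le_trans (eLpNorm_congr_ae ?_).le (eLpNorm_add_le
        ((memLp_gradient (φ n) _).sub (Lp.memLp (weakGrad U u))).1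
        ((memLp_gradient (ψ n) _).sub (Lp.memLp (weakGrad U v))).1 (by norm_num))
      filter_upwards [Lp.coeFn_add (weakGrad U u) (weakGrad U v)] with x hx
      simp only [hx, Pi.add_apply, gradient_add_test]
      abel
  smul_mem' := by
    rintro c u ⟨hu, φ, h1, h2⟩
    have hG := (weakGrad_spec hu).smul c
    refine ⟨⟨_, hG⟩, fun n => c • φ n, ?_, ?_⟩
    · have := ENNReal.Tendsto.const_mul (a := ‖c‖ₑ) h1 (Or.inr (by simp))
      rw [mul_zero] at this
      refine this.congr fun n => ?_
      rw [← eLpNorm_const_smul]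
      refine eLpNorm_congr_ae ?_
      filter_upwards [Lp.coeFn_smul c u] with x hx
      simp [hx, mul_sub]
    · have := ENNReal.Tendsto.const_mul (a := ‖c‖ₑ) h2 (Or.inr (by simp))
      rw [mul_zero] at this
      refine this.congr fun n => ?_
      rw [← eLpNorm_const_smul, hG.weakGrad_eq]
      refine eLpNorm_congr_ae ?_
      filter_upwards [Lp.coeFn_smul c (weakGrad U u)] with x hx
      simp only [hx, Pi.smul_apply, gradient_smul_test, smul_sub]

/-! ### The partition and its interfaces -/

/-- The open box `∏ₖ (aₖ, bₖ)`: an open interval for `d = 1`, an open axis-aligned rectangle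
for `d = 2`. -/
def openBox {d : ℕ} (a b : Fin d → ℝ) : Opens (Space d) where
  carrier := {x | ∀ k, a k < x k ∧ x k < b k}
  is_open' := by
    have : {x : Space d | ∀ k, a k < x k ∧ x k < b k} =
        ⋂ k, ({x : Space d | a k < x k} ∩ {x : Space d | x k < b k}) := by
      ext; simp
    rw [this]
    refine isOpen_iInter_of_finite fun k => ?_
    exact (isOpen_lt (by fun_prop) (by fun_prop)).inter (isOpen_lt (by fun_prop) (by fun_prop))

/-- A partition of the open box `Ω = ∏ₖ (aₖ, bₖ)` into finitely many non-overlapping nonempty open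
boxes `Ω₁, …, Ω_I`. -/
structure BoxPartition {d : ℕ} (a b : Fin d → ℝ) where
  /-- the number `I` of subdomains -/
  card : ℕ
  lower : Fin card → Fin d → ℝ
  upper : Fin card → Fin d → ℝ
  lower_lt_upper : ∀ i k, lower i k < upper i k
  subset : ∀ i, (openBox (lower i) (upper i) : Set (Space d)) ⊆ openBox a b
  disjoint : ∀ i j, i ≠ j → Disjoint (openBox (lower i) (upper i) : Set (Space d))
    (openBox (lower j) (upper j))
  cover : closure (openBox a b : Set (Space d)) =
    ⋃ i, closure (openBox (lower i) (upper i) : Set (Space d))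

namespace BoxPartition

variable {d : ℕ} {a b : Fin d → ℝ}

/-- The subdomain `Ωᵢ`. -/
def cell (P : BoxPartition a b) (i : Fin P.card) : Opens (Space d) :=
  openBox (P.lower i) (P.upper i)

/-- The set `Γ` of interior interfaces: the points of `Ω` on a common boundary `∂Ωᵢ ∩ ∂Ωⱼ`,
`i ≠ j`. -/
def interface (P : BoxPartition a b) : Set (Space d) :=
  (openBox a b : Set (Space d)) ∩ {x | ∃ i j : Fin P.card, i ≠ j ∧
    x ∈ frontier (P.cell i : Set (Space d)) ∩ frontier (P.cell j : Set (Space d))}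

/-- The surface measure on `Γ`: the `(d-1)`-dimensional Hausdorff measure, normalized so that
it is the counting measure for `d = 1`, length for `d = 2`, area for `d = 3`. -/
def surface (P : BoxPartition a b) : Measure (Space d) :=
  (Measure.euclideanHausdorffMeasure (d - 1)).restrict P.interface

/-- The piecewise constant coefficient with value `pᵢ` on `Ωᵢ`. -/
def coeff (P : BoxPartition a b) (p : Fin P.card → ℝ) (x : Space d) : ℝ :=
  ∑ i, (P.cell i : Set (Space d)).indicator (fun _ => p i) x

/-- The flux `p∇u`. -/
def flux (P : BoxPartition a b) (p : Fin P.card → ℝ) (u : L2 (openBox a b)) :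
    Space d → Space d :=
  fun x => P.coeff p x • weakGrad (openBox a b) u x

/-- `g ∈ L²(Γ)` is the jump `[σ · n]` of a field `σ` that belongs to `H(div, Ωᵢ)` for all `i`: the
sum over the subdomains of the (outward) normal traces of `σ`, as a functional on `C_c^∞(Ω)`,
is `φ ↦ ∫_Γ g φ dS`. -/
def IsJump (P : BoxPartition a b) (σ : Space d → Space d) (g : Lp ℝ 2 P.surface) : Prop :=
  ∀ φ : 𝓓(openBox a b, ℝ), ∑ i, normalTrace (P.cell i) σ φ = ∫ x, g x * φ x ∂P.surface

open Classical in
/-- The jump `[σ · n] ∈ L²(Γ)` (it is unique; the value is `0` if there is none). -/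
def jump (P : BoxPartition a b) (σ : Space d → Space d) : Lp ℝ 2 P.surface :=
  if h : ∃ g, P.IsJump σ g then h.choose else 0

lemma frontier_openBox_subset (l u : Fin d → ℝ) :
    frontier (openBox l u : Set (Space d)) ⊆
      ⋃ k, ({x : Space d | x k = l k} ∪ {x : Space d | x k = u k}) := by
  intro x hx
  have hcl : ∀ k, l k ≤ x k ∧ x k ≤ u k := by
    have hc : IsClosed {x : Space d | ∀ k, l k ≤ x k ∧ x k ≤ u k} := by
      have : {x : Space d | ∀ k, l k ≤ x k ∧ x k ≤ u k} =
          ⋂ k, ({x : Space d | l k ≤ x k} ∩ {x : Space d | x k ≤ u k}) := by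
        ext; simp
      rw [this]
      exact isClosed_iInter fun k => (isClosed_le (by fun_prop) (by fun_prop)).inter
        (isClosed_le (by fun_prop) (by fun_prop))
    exact closure_minimal (fun y hy k => ⟨(hy k).1.le, (hy k).2.le⟩) hc hx.1
  have hno : x ∉ (openBox l u : Set (Space d)) := by
    have := hx.2
    rwa [(openBox l u).isOpen.interior_eq] at this
  by_contra hcon
  simp only [Set.mem_iUnion, Set.mem_union, Set.mem_ofPred_eq, not_exists, not_or] at hcon
  exact hno fun k => ⟨lt_of_le_of_ne (hcl k).1 (Ne.symm (hcon k).1),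
    lt_of_le_of_ne (hcl k).2 (hcon k).2⟩

lemma hausdorff_slice_lt_top (l u : Fin d → ℝ) (k : Fin d) (c : ℝ) :
    (Measure.euclideanHausdorffMeasure (d - 1) : Measure (Space d))
      ({x | x k = c} ∩ (openBox l u : Set (Space d))) < ⊤ := by
  cases d with
  | zero => exact k.elim0
  | succ n =>
    let f : Space n → Space (n + 1) := fun y => WithLp.toLp 2 (k.insertNth c (fun j => y j))
    have hf : Isometry f := by
      refine Isometry.of_dist_eq fun y z => ?_
      rw [EuclideanSpace.dist_eq, EuclideanSpace.dist_eq, Fin.sum_univ_succAbove _ k]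
      simp [f]
    have hsub : ({x | x k = c} ∩ (openBox l u : Set (Space (n + 1)))) ⊆
        f '' (openBox (fun j => l (k.succAbove j)) (fun j => u (k.succAbove j)) :
          Set (Space n)) := by
      rintro x ⟨hx, hx'⟩
      refine ⟨WithLp.toLp 2 fun j => x (k.succAbove j), fun j => hx' _, ?_⟩
      ext j
      refine Fin.succAboveCases k ?_ (fun j => ?_) j
      · simpa [f] using hx.symm
      · simp [f]
    refine (measure_mono hsub).trans_lt ?_
    rw [Nat.add_sub_cancel, hf.euclideanHausdorffMeasure_image,
      EuclideanSpace.euclideanHausdorffMeasure_eq_volume]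
    have hb : (openBox (fun j => l (k.succAbove j)) (fun j => u (k.succAbove j)) :
        Set (Space n)) ⊆ (MeasurableEquiv.toLp 2 (Fin n → ℝ)).symm ⁻¹'
          Set.Icc (fun j => l (k.succAbove j)) (fun j => u (k.succAbove j)) :=
      fun y hy => ⟨fun j => (hy j).1.le, fun j => (hy j).2.le⟩
    refine (measure_mono hb).trans_lt ?_
    rw [(EuclideanSpace.volume_preserving_symm_measurableEquiv_toLp (Fin n)).measure_preimage_equiv]
    exact isCompact_Icc.measure_lt_top

instance (P : BoxPartition a b) : IsFiniteMeasure P.surface := by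
  refine ⟨?_⟩
  rw [surface, Measure.restrict_apply_univ]
  have hsub : P.interface ⊆ ⋃ i : Fin P.card, ⋃ k : Fin d,
      (({x | x k = P.lower i k} ∩ (openBox a b : Set (Space d))) ∪
        ({x | x k = P.upper i k} ∩ (openBox a b : Set (Space d)))) := by
    rintro x ⟨hx, i, j, -, hi, -⟩
    have := frontier_openBox_subset _ _ hi
    simp only [Set.mem_iUnion, Set.mem_union, Set.mem_inter_iff, Set.mem_ofPred_eq] at this ⊢
    obtain ⟨k, hk⟩ := this
    exact ⟨i, k, hk.imp (fun h => ⟨h, hx⟩) (fun h => ⟨h, hx⟩)⟩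
  refine (measure_mono hsub).trans_lt ?_
  refine (measure_iUnion_le _).trans_lt ?_
  rw [tsum_fintype, ENNReal.sum_lt_top]
  intro i _
  refine (measure_iUnion_le _).trans_lt ?_
  rw [tsum_fintype, ENNReal.sum_lt_top]
  intro k _
  exact (measure_union_le _ _).trans_lt
    (ENNReal.add_lt_top.2 ⟨hausdorff_slice_lt_top _ _ _ _, hausdorff_slice_lt_top _ _ _ _⟩)

lemma ae_cell_of_ae {P : BoxPartition a b} {q : Space d → Prop} (i : Fin P.card)
    (h : ∀ᵐ x ∂(volume.restrict (openBox a b : Set (Space d))), q x) :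
    ∀ᵐ x ∂(volume.restrict (P.cell i : Set (Space d))), q x :=
  ae_mono (Measure.restrict_mono (P.subset i) le_rfl) h

lemma flux_add (P : BoxPartition a b) (p : Fin P.card → ℝ) {u v : L2 (openBox a b)}
    (hu : u ∈ H10 (openBox a b)) (hv : v ∈ H10 (openBox a b)) :
    P.flux p u + P.flux p v =ᵐ[volume.restrict (openBox a b : Set (Space d))]
      P.flux p (u + v) := by
  have h := ((weakGrad_spec hu.1).add (weakGrad_spec hv.1)).weakGrad_eq
  filter_upwards [Lp.coeFn_add (weakGrad _ u) (weakGrad _ v)] with x hx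
  simp only [flux, Pi.add_apply, h, hx, smul_add]

lemma flux_smul (P : BoxPartition a b) (p : Fin P.card → ℝ) (c : ℝ) {u : L2 (openBox a b)}
    (hu : u ∈ H10 (openBox a b)) :
    c • P.flux p u =ᵐ[volume.restrict (openBox a b : Set (Space d))] P.flux p (c • u) := by
  have h := ((weakGrad_spec hu.1).smul c).weakGrad_eq
  filter_upwards [Lp.coeFn_smul c (weakGrad _ u)] with x hx
  simp only [flux, Pi.smul_apply, h, hx]
  rw [smul_comm]

lemma flux_zero (P : BoxPartition a b) (p : Fin P.card → ℝ) :
    (fun _ => 0) =ᵐ[volume.restrict (openBox a b : Set (Space d))] P.flux p 0 := by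
  filter_upwards [Lp.coeFn_zero (Space d) 2 (volume.restrict (openBox a b : Set (Space d)))]
    with x hx
  rw [flux, isWeakGrad_zero.weakGrad_eq, hx]; simp

/-! ### The space `𝕏ᵖ` and its norms -/

/-- `𝕏ᵖ = {u ∈ H¹₀(Ω) : (p∇u)|_{Ωᵢ} ∈ H(div, Ωᵢ) for all i, [p∇u · n] ∈ L²(Γ)}`. -/
def Xp (P : BoxPartition a b) (p : Fin P.card → ℝ) : Submodule ℝ (L2 (openBox a b)) where
  carrier := {u | u ∈ H10 (openBox a b) ∧ (∀ i, MemHdiv (P.cell i) (P.flux p u)) ∧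
    ∃ g, P.IsJump (P.flux p u) g}
  zero_mem' := by
    have h0 : ∀ i, IsWeakDiv (P.cell i) (fun _ => 0) 0 := by
      intro i φ
      rw [integral_eq_zero_of_ae (f := fun x => (0 : L2 (P.cell i)) x * φ x)]
      · simp
      · filter_upwards [Lp.coeFn_zero ℝ 2 (volume.restrict (P.cell i : Set (Space d)))] with x hx
        rw [hx]; simp
    have h1 : ∀ i, MemHdiv (P.cell i) (fun _ => 0) := fun i => ⟨MemLp.zero', 0, h0 i⟩
    refine ⟨Submodule.zero_mem _, fun i => (h1 i).congr (ae_cell_of_ae i (P.flux_zero p)),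
      0, fun φ => ?_⟩
    rw [integral_eq_zero_of_ae (f := fun x => (0 : Lp ℝ 2 P.surface) x * φ x)]
    · refine Finset.sum_eq_zero fun i _ => ?_
      rw [← normalTrace_congr (h1 i) (ae_cell_of_ae i (P.flux_zero p)), normalTrace,
        (h0 i).weakDiv_eq]
      refine integral_eq_zero_of_ae ?_
      filter_upwards [Lp.coeFn_zero ℝ 2 (volume.restrict (P.cell i : Set (Space d)))] with x hx
      rw [hx]; simp
    · filter_upwards [Lp.coeFn_zero ℝ 2 P.surface] with x hx
      rw [hx]; simp
  add_mem' := by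
    rintro u v ⟨hu, hu', g, hg⟩ ⟨hv, hv', g', hg'⟩
    have e := P.flux_add p hu hv
    refine ⟨Submodule.add_mem _ hu hv, fun i => ((hu' i).add (hv' i)).congr (ae_cell_of_ae i e),
      g + g', fun φ => ?_⟩
    have m := memLp_test φ P.surface
    calc ∑ i, normalTrace (P.cell i) (P.flux p (u + v)) φ
        = ∑ i, (normalTrace (P.cell i) (P.flux p u) φ
            + normalTrace (P.cell i) (P.flux p v) φ) := by
          refine Finset.sum_congr rfl fun i _ => ?_
          rw [← normalTrace_congr ((hu' i).add (hv' i)) (ae_cell_of_ae i e),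
            normalTrace_add (hu' i) (hv' i)]
      _ = ∫ x, (g x * φ x + g' x * φ x) ∂P.surface := by
          rw [Finset.sum_add_distrib, hg φ, hg' φ, integral_add
            (integrable_mul (Lp.memLp g) m) (integrable_mul (Lp.memLp g') m)]
      _ = _ := by
          refine integral_congr_ae ?_
          filter_upwards [Lp.coeFn_add g g'] with x hx
          rw [hx, Pi.add_apply, add_mul]
  smul_mem' := by
    rintro c u ⟨hu, hu', g, hg⟩
    have e := P.flux_smul p c hu
    refine ⟨Submodule.smul_mem _ c hu, fun i => ((hu' i).smul c).congr (ae_cell_of_ae i e),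
      c • g, fun φ => ?_⟩
    calc ∑ i, normalTrace (P.cell i) (P.flux p (c • u)) φ
        = ∑ i, c * normalTrace (P.cell i) (P.flux p u) φ := by
          refine Finset.sum_congr rfl fun i _ => ?_
          rw [← normalTrace_congr ((hu' i).smul c) (ae_cell_of_ae i e),
            normalTrace_smul c (hu' i)]
      _ = ∫ x, c * (g x * φ x) ∂P.surface := by
          rw [← Finset.mul_sum, hg φ, integral_const_mul]
      _ = _ := by
          refine integral_congr_ae ?_
          filter_upwards [Lp.coeFn_smul c g] with x hx
          rw [hx, Pi.smul_apply, smul_eq_mul, mul_assoc]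

/-- `‖u‖_{H¹₀} = ‖∇u‖_{L²(Ω)}`. -/
def normH10 (_P : BoxPartition a b) (u : L2 (openBox a b)) : ℝ :=
  ‖weakGrad (openBox a b) u‖

/-- The piecewise divergence `div(p∇u)` on `Ω ∖ Γ`. -/
def divFlux (P : BoxPartition a b) (p : Fin P.card → ℝ) (u : L2 (openBox a b)) (x : Space d) : ℝ :=
  ∑ i, (P.cell i : Set (Space d)).indicator (fun y => weakDiv (P.cell i) (P.flux p u) y) x

/-- The jump `[p∇u · n] ∈ L²(Γ)`. -/
def jumpFlux (P : BoxPartition a b) (p : Fin P.card → ℝ) (u : L2 (openBox a b)) :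
    Lp ℝ 2 P.surface :=
  P.jump (P.flux p u)

/-- The residual norm `(‖div(p∇u)‖²_{L²(Ω)} + Θ ‖[p∇u · n]‖²_{L²(Γ)})^{1/2}`. -/
def resNorm (P : BoxPartition a b) (p : Fin P.card → ℝ) (Θ : ℝ) (u : L2 (openBox a b)) : ℝ :=
  √((lpNorm (P.divFlux p u) 2 (volume.restrict (openBox a b : Set (Space d)))) ^ 2
    + Θ * ‖P.jumpFlux p u‖ ^ 2)

/-- The graph norm
`(‖u‖²_{H¹₀} + ∑ᵢ ‖div(p∇u)‖²_{L²(Ωᵢ)} + ‖[p∇u · n]‖²_{L²(Γ)})^{1/2}`. -/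
def graphNorm (P : BoxPartition a b) (p : Fin P.card → ℝ) (u : L2 (openBox a b)) : ℝ :=
  √((P.normH10 u) ^ 2 + ∑ i, ‖weakDiv (P.cell i) (P.flux p u)‖ ^ 2 + ‖P.jumpFlux p u‖ ^ 2)

/-- `w` is the weak solution of the transmission problem with source `ℓ`:
`w ∈ H¹₀(Ω)` and `∫_Ω p∇w · ∇v = ∫_Ω ℓ v` for all `v ∈ H¹₀(Ω)`. -/
def IsWeakSolution (P : BoxPartition a b) (p : Fin P.card → ℝ) (ℓ w : L2 (openBox a b)) : Prop :=
  w ∈ H10 (openBox a b) ∧ ∀ v ∈ H10 (openBox a b),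
    ∫ x in (openBox a b : Set (Space d)), inner ℝ (P.flux p w x) (weakGrad (openBox a b) v x) =
      ∫ x in (openBox a b : Set (Space d)), ℓ x * v x

end BoxPartition

/-- `N` is a norm on the real vector space `V`. -/
def IsNorm {V : Type*} [AddCommGroup V] [Module ℝ V] (N : V → ℝ) : Prop :=
  (∀ u v, N (u + v) ≤ N u + N v) ∧ (∀ (c : ℝ) (u : V), N (c • u) = |c| * N u) ∧
    ∀ u, N u = 0 → u = 0

end

end Transmission

/-!
Friedrichs' inequality on the lines parallel to a coordinate axis, integrated over the transverse
variables, bounds a test function by its gradient both in `L²(Ω)` and in `L²` of any hyperplane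
orthogonal to that axis. As `Γ` lies in finitely many such hyperplanes, this gives the Poincaré
inequality and a trace inequality whose constant only depends on `Γ`.

Adding up the definitions of the normal traces,
`∫_Ω p∇u · ∇φ = ∫_Γ [p∇u · n] φ dS - ∫_Ω div(p∇u) φ` for test functions `φ`, and the right-hand
side is at most `C ‖u‖_{𝕏ᵖ} ‖∇φ‖`. Only the gradient of `φ` is left, so one may let `φ` tend to `u`
in `H¹₀(Ω)`, and coercivity gives `min p ‖∇u‖² ≤ C ‖u‖_{𝕏ᵖ} ‖∇u‖`. A weak solution `w` has the
global divergence `div(p∇w) = -ℓ` and hence no jump, so that the estimate applies to `u - w`.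
-/

namespace Transmission

open scoped InnerProductSpace

section Friedrichs

variable {F : Type*} [NormedAddCommGroup F] [NormedSpace ℝ F] {f : ℝ → F} {α β p : ℝ}

lemma deriv_eq_zero_of_notMem_Icc (hf : ∀ t ∉ Set.Icc α β, f t = 0) {t : ℝ}
    (ht : t ∉ Set.Icc α β) : deriv f t = 0 := by
  have hloc : f =ᶠ[𝓝 t] fun _ => 0 := by
    filter_upwards [isClosed_Icc.isOpen_compl.mem_nhds ht] with s hs using hf s hs
  simpa using hloc.deriv_eq

lemma enorm_le_setLIntegral_enorm_deriv (hf : ContDiff ℝ 1 f) (hf₀ : ∀ t ∉ Set.Icc α β, f t = 0)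
    (x : ℝ) : ‖f x‖ₑ ≤ ∫⁻ t in Set.Icc α β, ‖deriv f t‖ₑ :=
  calc ‖f x‖ₑ ≤ ∫⁻ t in Set.Iic x, ‖deriv f t‖ₑ :=
        HasCompactSupport.enorm_le_lintegral_Ici_deriv hf
          (HasCompactSupport.intro isCompact_Icc hf₀) x
    _ ≤ ∫⁻ t, ‖deriv f t‖ₑ := setLIntegral_le_lintegral _ _
    _ = ∫⁻ t in Set.Icc α β, ‖deriv f t‖ₑ := by
        refine (setLIntegral_eq_of_support_subset ?_).symm
        refine Function.support_subset_iff'.2 fun t ht => ?_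
        rw [deriv_eq_zero_of_notMem_Icc hf₀ ht, enorm_zero]

lemma enorm_rpow_le_lintegral_enorm_deriv_rpow (hp : 1 ≤ p) (hf : ContDiff ℝ 1 f)
    (hf₀ : ∀ t ∉ Set.Icc α β, f t = 0) (x : ℝ) :
    ‖f x‖ₑ ^ p ≤ ENNReal.ofReal (β - α) ^ (p - 1) * ∫⁻ t, ‖deriv f t‖ₑ ^ p := by
  have hp₀ : 0 < p := by positivity
  have hölder := eLpNorm'_le_eLpNorm'_mul_rpow_measure_univ one_pos hp
    (hf.continuous_deriv le_rfl).aestronglyMeasurable (μ := volume.restrict (Set.Icc α β))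
  simp only [eLpNorm'_eq_lintegral_enorm, ENNReal.rpow_one, div_one, Measure.restrict_apply_univ,
    Real.volume_Icc] at hölder
  calc ‖f x‖ₑ ^ p
      ≤ ((∫⁻ t in Set.Icc α β, ‖deriv f t‖ₑ ^ p) ^ (1 / p) *
          ENNReal.ofReal (β - α) ^ (1 - 1 / p)) ^ p :=
        ENNReal.rpow_le_rpow ((enorm_le_setLIntegral_enorm_deriv hf hf₀ x).trans hölder) hp₀.le
    _ = ENNReal.ofReal (β - α) ^ (p - 1) * ∫⁻ t in Set.Icc α β, ‖deriv f t‖ₑ ^ p := by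
        rw [ENNReal.mul_rpow_of_nonneg _ _ hp₀.le, ← ENNReal.rpow_mul, ← ENNReal.rpow_mul,
          one_div_mul_cancel hp₀.ne', ENNReal.rpow_one, sub_mul, one_div_mul_cancel hp₀.ne',
          one_mul, mul_comm]
    _ ≤ _ := by gcongr; exact Measure.restrict_le_self

lemma lintegral_enorm_rpow_le_lintegral_enorm_deriv_rpow (hp : 1 ≤ p) (hf : ContDiff ℝ 1 f)
    (hf₀ : ∀ t ∉ Set.Icc α β, f t = 0) :
    ∫⁻ t, ‖f t‖ₑ ^ p ≤ ENNReal.ofReal (β - α) ^ p * ∫⁻ t, ‖deriv f t‖ₑ ^ p := by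
  have hp₀ : 0 < p := by positivity
  calc ∫⁻ t, ‖f t‖ₑ ^ p = ∫⁻ t in Set.Icc α β, ‖f t‖ₑ ^ p := by
        refine (setLIntegral_eq_of_support_subset ?_).symm
        refine Function.support_subset_iff'.2 fun t ht => ?_
        rw [hf₀ t ht, enorm_zero, ENNReal.zero_rpow_of_pos hp₀]
    _ ≤ ∫⁻ _ in Set.Icc α β, ENNReal.ofReal (β - α) ^ (p - 1) * ∫⁻ t, ‖deriv f t‖ₑ ^ p :=
        lintegral_mono fun t => enorm_rpow_le_lintegral_enorm_deriv_rpow hp hf hf₀ t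
    _ = ENNReal.ofReal (β - α) ^ (p - 1 + 1) * ∫⁻ t, ‖deriv f t‖ₑ ^ p := by
        rw [setLIntegral_const, Real.volume_Icc,
          ENNReal.rpow_add_of_nonneg _ _ (by linarith) zero_le_one, ENNReal.rpow_one]
        ring
    _ = _ := by rw [sub_add_cancel]

end Friedrichs

section Slices

variable {n : ℕ}

/-- The point of `ℝⁿ⁺¹` with `k`-th coordinate `t` and remaining coordinates `y`: it parametrizes
the lines parallel to the `k`-th axis (by `t`) and the hyperplanes orthogonal to it (by `y`). -/
def sliceMap (k : Fin (n + 1)) (t : ℝ) (y : Space n) : Space (n + 1) :=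
  WithLp.toLp 2 (k.insertNth t y.ofLp)

@[simp]
lemma sliceMap_apply_same (k : Fin (n + 1)) (t : ℝ) (y : Space n) : sliceMap k t y k = t := by
  simp [sliceMap]

lemma sliceMap_eq_add_smul_single (k : Fin (n + 1)) (t : ℝ) (y : Space n) :
    sliceMap k t y = sliceMap k 0 y + t • EuclideanSpace.single k 1 := by
  ext j
  refine Fin.succAboveCases k ?_ (fun j => ?_) j <;> simp [sliceMap]

lemma hasDerivAt_sliceMap (k : Fin (n + 1)) (t : ℝ) (y : Space n) :
    HasDerivAt (fun s => sliceMap k s y) (EuclideanSpace.single k 1) t := by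
  rw [funext fun s => sliceMap_eq_add_smul_single k s y]
  simpa using ((hasDerivAt_id t).smul_const (EuclideanSpace.single k (1 : ℝ))).const_add
    (sliceMap k 0 y)

lemma contDiff_sliceMap (k : Fin (n + 1)) (y : Space n) {r : WithTop ℕ∞} :
    ContDiff ℝ r fun t => sliceMap k t y := by
  rw [funext fun s => sliceMap_eq_add_smul_single k s y]
  fun_prop

lemma isometry_sliceMap (k : Fin (n + 1)) (t : ℝ) : Isometry (sliceMap k t) :=
  Isometry.of_dist_eq fun y z => by
    simp [EuclideanSpace.dist_eq, Fin.sum_univ_succAbove _ k, sliceMap]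

lemma range_sliceMap (k : Fin (n + 1)) (t : ℝ) :
    Set.range (sliceMap k t) = {x : Space (n + 1) | x k = t} := by
  ext x
  refine ⟨?_, fun hx => ⟨WithLp.toLp 2 fun j => x (k.succAbove j), ?_⟩⟩
  · rintro ⟨y, rfl⟩
    exact sliceMap_apply_same k t y
  · ext j
    refine Fin.succAboveCases k ?_ (fun j => ?_) j
    · simpa [sliceMap] using hx.symm
    · simp [sliceMap]

lemma measurePreserving_sliceMap (k : Fin (n + 1)) :
    MeasurePreserving (fun z : ℝ × Space n => sliceMap k z.1 z.2) :=
  (PiLp.volume_preserving_toLp (Fin (n + 1))).comp <|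
    (volume_preserving_piFinSuccAbove (fun _ => ℝ) k).symm.comp <|
      (MeasurePreserving.id volume).prod (PiLp.volume_preserving_ofLp (Fin n))

lemma lintegral_eq_lintegral_lintegral_sliceMap (k : Fin (n + 1)) {f : Space (n + 1) → ℝ≥0∞}
    (hf : Measurable f) : ∫⁻ x, f x = ∫⁻ y : Space n, ∫⁻ t, f (sliceMap k t y) := by
  have hslice := measurePreserving_sliceMap k
  rw [← hslice.lintegral_comp hf, Measure.volume_eq_prod]
  exact lintegral_prod_symm' _ (hf.comp hslice.measurable)

lemma setLIntegral_hyperplane_eq_lintegral_sliceMap (k : Fin (n + 1)) (t : ℝ)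
    {f : Space (n + 1) → ℝ≥0∞} (hf : Measurable f) :
    ∫⁻ x in {x | x k = t}, f x ∂Measure.euclideanHausdorffMeasure n =
      ∫⁻ y : Space n, f (sliceMap k t y) := by
  have hslice := isometry_sliceMap k t
  rw [← range_sliceMap, ← hslice.map_euclideanHausdorffMeasure,
    lintegral_map hf hslice.continuous.measurable,
    EuclideanSpace.euclideanHausdorffMeasure_eq_volume]

end Slices

section Slabs

variable {F : Type*} [NormedAddCommGroup F] [NormedSpace ℝ F]

lemma enorm_deriv_comp_sliceMap_le {n : ℕ} {φ : Space (n + 1) → F} (hφ : Differentiable ℝ φ)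
    (k : Fin (n + 1)) (y : Space n) (t : ℝ) :
    ‖deriv (fun s => φ (sliceMap k s y)) t‖ₑ ≤ ‖fderiv ℝ φ (sliceMap k t y)‖ₑ := by
  have hderiv : HasDerivAt (fun s => φ (sliceMap k s y))
      (fderiv ℝ φ (sliceMap k t y) (EuclideanSpace.single k 1)) t :=
    (hφ _).hasFDerivAt.comp_hasDerivAt t (hasDerivAt_sliceMap k t y)
  rw [hderiv.deriv]
  refine ((fderiv ℝ φ (sliceMap k t y)).le_opENorm _).trans_eq ?_
  rw [← ofReal_norm (EuclideanSpace.single k (1 : ℝ)), PiLp.norm_single]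
  simp

variable {d : ℕ} {φ : Space d → F} {k : Fin d} {α β p : ℝ}

lemma lintegral_enorm_rpow_le_of_slab (hp : 1 ≤ p) (hφ : ContDiff ℝ 1 φ)
    (hφ₀ : ∀ x, x k ∉ Set.Icc α β → φ x = 0) :
    ∫⁻ x, ‖φ x‖ₑ ^ p ≤ ENNReal.ofReal (β - α) ^ p * ∫⁻ x, ‖fderiv ℝ φ x‖ₑ ^ p := by
  cases d with
  | zero => exact k.elim0
  | succ n =>
    have hφm := hφ.continuous.enorm.measurable.pow_const p
    have hdφm := (hφ.continuous_fderiv one_ne_zero).enorm.measurable.pow_const p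
    rw [lintegral_eq_lintegral_lintegral_sliceMap k hφm,
      lintegral_eq_lintegral_lintegral_sliceMap k hdφm,
      ← lintegral_const_mul' _ _ (by finiteness)]
    gcongr with y
    calc ∫⁻ t, ‖φ (sliceMap k t y)‖ₑ ^ p
        ≤ ENNReal.ofReal (β - α) ^ p * ∫⁻ t, ‖deriv (fun s => φ (sliceMap k s y)) t‖ₑ ^ p :=
          lintegral_enorm_rpow_le_lintegral_enorm_deriv_rpow hp
            (hφ.comp (contDiff_sliceMap k y)) fun t ht => hφ₀ _ (by simpa using ht)
      _ ≤ _ := by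
          gcongr with t
          exact enorm_deriv_comp_sliceMap_le (hφ.differentiable one_ne_zero) k y t

lemma setLIntegral_hyperplane_enorm_rpow_le_of_slab (hp : 1 ≤ p) (hφ : ContDiff ℝ 1 φ)
    (hφ₀ : ∀ x, x k ∉ Set.Icc α β → φ x = 0) (c : ℝ) :
    ∫⁻ x in {x | x k = c}, ‖φ x‖ₑ ^ p ∂Measure.euclideanHausdorffMeasure (d - 1) ≤
      ENNReal.ofReal (β - α) ^ (p - 1) * ∫⁻ x, ‖fderiv ℝ φ x‖ₑ ^ p := by
  cases d with
  | zero => exact k.elim0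
  | succ n =>
    have hφm := hφ.continuous.enorm.measurable.pow_const p
    have hdφm := (hφ.continuous_fderiv one_ne_zero).enorm.measurable.pow_const p
    rw [Nat.add_sub_cancel, setLIntegral_hyperplane_eq_lintegral_sliceMap k c hφm,
      lintegral_eq_lintegral_lintegral_sliceMap k hdφm,
      ← lintegral_const_mul' _ _ (ENNReal.rpow_ne_top_of_nonneg (by linarith) (by finiteness))]
    gcongr with y
    calc ‖φ (sliceMap k c y)‖ₑ ^ p
        ≤ ENNReal.ofReal (β - α) ^ (p - 1) *
            ∫⁻ t, ‖deriv (fun s => φ (sliceMap k s y)) t‖ₑ ^ p :=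
          enorm_rpow_le_lintegral_enorm_deriv_rpow hp (hφ.comp (contDiff_sliceMap k y))
            (fun t ht => hφ₀ _ (by simpa using ht)) c
      _ ≤ _ := by
          gcongr with t
          exact enorm_deriv_comp_sliceMap_le (hφ.differentiable one_ne_zero) k y t

lemma setLIntegral_biUnion_hyperplane_enorm_rpow_le {a b : Fin d → ℝ} (hp : 1 ≤ p)
    (hφ : ContDiff ℝ 1 φ) (hφ₀ : ∀ x, ∀ k, x k ∉ Set.Icc (a k) (b k) → φ x = 0)
    (S : Finset (Fin d × ℝ)) :
    ∫⁻ x in ⋃ q ∈ S, {x | x q.1 = q.2}, ‖φ x‖ₑ ^ p ∂Measure.euclideanHausdorffMeasure (d - 1) ≤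
      (∑ q ∈ S, ENNReal.ofReal (b q.1 - a q.1) ^ (p - 1)) * ∫⁻ x, ‖fderiv ℝ φ x‖ₑ ^ p := by
  have hunion : ⋃ q ∈ S, {x : Space d | x q.1 = q.2} = ⋃ q : S, {x | x q.1.1 = q.1.2} :=
    Set.biUnion_eq_iUnion (S : Set (Fin d × ℝ)) fun q _ => {x : Space d | x q.1 = q.2}
  rw [hunion, Finset.sum_mul, ← Finset.sum_coe_sort]
  refine (lintegral_iUnion_le _ _).trans ?_
  rw [tsum_fintype]
  exact Finset.sum_le_sum fun q _ =>
    setLIntegral_hyperplane_enorm_rpow_le_of_slab hp hφ (fun x => hφ₀ x q.1.1) q.1.2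

end Slabs

section Generalities

variable {E α : Type*} [NormedAddCommGroup E] [MeasurableSpace α] {μ : Measure α} {f : α → E}

lemma enorm_toLp_rpow_two (hf : MemLp f 2 μ) :
    ‖hf.toLp f‖ₑ ^ (2 : ℝ) = ∫⁻ x, ‖f x‖ₑ ^ (2 : ℝ) ∂μ := by
  rw [Lp.enorm_toLp]
  simpa using eLpNorm_nnreal_pow_eq_lintegral (p := 2) two_ne_zero (f := f) (μ := μ)

lemma inner_toLp_right [InnerProductSpace ℝ E] (g : Lp E 2 μ) (hf : MemLp f 2 μ) :
    ⟪g, hf.toLp f⟫_ℝ = ∫ x, ⟪g x, f x⟫_ℝ ∂μ := by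
  rw [L2.inner_def]
  refine integral_congr_ae ?_
  filter_upwards [hf.coeFn_toLp] with x hx
  rw [hx]

lemma inner_toLp_left [InnerProductSpace ℝ E] (hf : MemLp f 2 μ) (g : Lp E 2 μ) :
    ⟪hf.toLp f, g⟫_ℝ = ∫ x, ⟪f x, g x⟫_ℝ ∂μ := by
  rw [real_inner_comm, inner_toLp_right]
  simp only [real_inner_comm]

lemma norm_le_mul_norm_of_enorm_rpow_two_le {E F : Type*} [SeminormedAddCommGroup E]
    [SeminormedAddCommGroup F] {u : E} {v : F} {c : ℝ} (hc : 0 ≤ c)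
    (h : ‖u‖ₑ ^ (2 : ℝ) ≤ ENNReal.ofReal c ^ (2 : ℝ) * ‖v‖ₑ ^ (2 : ℝ)) : ‖u‖ ≤ c * ‖v‖ := by
  rw [← ENNReal.mul_rpow_of_nonneg _ _ zero_le_two, ENNReal.rpow_le_rpow_iff two_pos,
    ← ofReal_norm, ← ofReal_norm, ← ENNReal.ofReal_mul hc] at h
  exact (ENNReal.ofReal_le_ofReal_iff (by positivity)).1 h

lemma enorm_gradient {V : Type*} [NormedAddCommGroup V] [InnerProductSpace ℝ V] [CompleteSpace V]
    (φ : V → ℝ) (x : V) : ‖gradient φ x‖ₑ = ‖fderiv ℝ φ x‖ₑ := by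
  simp [gradient]

end Generalities

section TestFunctions

variable {d : ℕ} {U : Opens (Space d)}

/-- A test function as an element of `L²(μ)`. -/
noncomputable def testLp (μ : Measure (Space d)) [IsFiniteMeasureOnCompacts μ]
    (φ : 𝓓(U, ℝ)) : Lp ℝ 2 μ :=
  (memLp_test φ μ).toLp φ

/-- The gradient of a test function as an element of `L²(U)ᵈ`. -/
noncomputable def testGrad (φ : 𝓓(U, ℝ)) : L2Vec U :=
  (memLp_gradient φ _).toLp (gradient φ)

lemma test_eq_zero_of_notMem (φ : 𝓓(U, ℝ)) {x : Space d} (hx : x ∉ U) : φ x = 0 :=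
  image_eq_zero_of_notMem_tsupport fun h => hx (φ.tsupport_subset h)

lemma gradient_test_eq_zero_of_notMem (φ : 𝓓(U, ℝ)) {x : Space d} (hx : x ∉ U) :
    gradient φ x = 0 := by
  have hfderiv : fderiv ℝ φ x = 0 :=
    image_eq_zero_of_notMem_tsupport fun h => hx (φ.tsupport_subset (tsupport_fderiv_subset ℝ h))
  rw [gradient, hfderiv, map_zero]

lemma gradient_test_apply (φ : 𝓓(U, ℝ)) (x : Space d) (k : Fin d) :
    gradient φ x k = fderiv ℝ φ x (EuclideanSpace.single k 1) := by
  rw [← inner_gradient_left, EuclideanSpace.inner_single_right]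
  simp

lemma inner_testLp {μ : Measure (Space d)} [IsFiniteMeasureOnCompacts μ] (g : Lp ℝ 2 μ)
    (φ : 𝓓(U, ℝ)) : ⟪g, testLp μ φ⟫_ℝ = ∫ x, g x * φ x ∂μ := by
  rw [testLp, inner_toLp_right]
  simp [mul_comm]

lemma inner_testGrad (σ : L2Vec U) (φ : 𝓓(U, ℝ)) :
    ⟪σ, testGrad φ⟫_ℝ = ∫ x in (U : Set (Space d)), ⟪σ x, gradient φ x⟫_ℝ :=
  inner_toLp_right σ _

lemma inner_toLp_testGrad {σ : Space d → Space d}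
    (hσ : MemLp σ 2 (volume.restrict (U : Set (Space d)))) (φ : 𝓓(U, ℝ)) :
    ⟪hσ.toLp σ, testGrad φ⟫_ℝ = ∫ x in (U : Set (Space d)), ⟪σ x, gradient φ x⟫_ℝ := by
  rw [inner_testGrad]
  refine integral_congr_ae ?_
  filter_upwards [hσ.coeFn_toLp] with x hx
  rw [hx]

lemma isWeakDiv_iff_inner {σ : Space d → Space d}
    (hσ : MemLp σ 2 (volume.restrict (U : Set (Space d)))) {f : L2 U} :
    IsWeakDiv U σ f ↔ ∀ φ : 𝓓(U, ℝ), ⟪hσ.toLp σ, testGrad φ⟫_ℝ = -⟪f, testLp _ φ⟫_ℝ := by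
  simp only [inner_toLp_testGrad, inner_testLp, IsWeakDiv]

lemma enorm_testLp_rpow_two (μ : Measure (Space d)) [IsFiniteMeasureOnCompacts μ] (φ : 𝓓(U, ℝ)) :
    ‖testLp μ φ‖ₑ ^ (2 : ℝ) = ∫⁻ x, ‖φ x‖ₑ ^ (2 : ℝ) ∂μ :=
  enorm_toLp_rpow_two _

lemma enorm_testGrad_rpow_two (φ : 𝓓(U, ℝ)) :
    ‖testGrad φ‖ₑ ^ (2 : ℝ) = ∫⁻ x, ‖fderiv ℝ φ x‖ₑ ^ (2 : ℝ) := by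
  rw [testGrad, enorm_toLp_rpow_two, setLIntegral_eq_of_support_subset]
  · simp only [enorm_gradient]
  · refine Function.support_subset_iff'.2 fun x hx => ?_
    rw [gradient_test_eq_zero_of_notMem φ hx, enorm_zero, ENNReal.zero_rpow_of_pos two_pos]

lemma integral_test_mul_gradient_apply (φ ψ : 𝓓(U, ℝ)) (k : Fin d) :
    ∫ x, φ x * gradient ψ x k = -∫ x, gradient φ x k * ψ x := by
  have hφ := memLp_test φ volume
  have hψ := memLp_test ψ volume
  have hφ' := memLp_coord (memLp_gradient φ volume) k
  have hψ' := memLp_coord (memLp_gradient ψ volume) k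
  simp only [gradient_test_apply] at hφ' hψ' ⊢
  exact integral_mul_fderiv_eq_neg_fderiv_mul_of_integrable (integrable_mul hφ' hψ)
    (integrable_mul hφ hψ') (integrable_mul hφ hψ) (fun x _ => differentiable_test φ x)
    (fun x _ => differentiable_test ψ x)

lemma isWeakGrad_testLp (φ : 𝓓(U, ℝ)) : IsWeakGrad U (testLp _ φ) (testGrad φ) := by
  intro ψ k
  calc ∫ x in (U : Set (Space d)), testLp _ φ x * gradient ψ x k
      = ∫ x in (U : Set (Space d)), φ x * gradient ψ x k := by
        refine integral_congr_ae ?_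
        filter_upwards [(memLp_test φ (volume.restrict (U : Set (Space d)))).coeFn_toLp] with x hx
        rw [testLp, hx]
    _ = ∫ x, φ x * gradient ψ x k :=
        setIntegral_eq_integral_of_forall_compl_eq_zero fun x hx => by
          rw [test_eq_zero_of_notMem φ hx, zero_mul]
    _ = -∫ x, gradient φ x k * ψ x := integral_test_mul_gradient_apply φ ψ k
    _ = -∫ x in (U : Set (Space d)), gradient φ x k * ψ x := by
        rw [setIntegral_eq_integral_of_forall_compl_eq_zero fun x hx => by
          rw [test_eq_zero_of_notMem ψ hx, mul_zero]]
    _ = -∫ x in (U : Set (Space d)), testGrad φ x k * ψ x := by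
        congr 1
        refine integral_congr_ae ?_
        filter_upwards [(memLp_gradient φ (volume.restrict (U : Set (Space d)))).coeFn_toLp]
          with x hx
        rw [testGrad, hx]

lemma weakGrad_testLp (φ : 𝓓(U, ℝ)) : weakGrad U (testLp _ φ) = testGrad φ :=
  (isWeakGrad_testLp φ).weakGrad_eq

lemma tendsto_testLp_iff {φ : ℕ → 𝓓(U, ℝ)} {u : L2 U} :
    Tendsto (fun n => testLp _ (φ n)) atTop (𝓝 u) ↔
      Tendsto (fun n => eLpNorm (fun x => φ n x - u x) 2 (volume.restrict (U : Set (Space d))))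
        atTop (𝓝 0) := by
  rw [Lp.tendsto_Lp_iff_tendsto_eLpNorm']
  refine tendsto_congr fun n => eLpNorm_congr_ae ?_
  filter_upwards [(memLp_test (φ n) (volume.restrict (U : Set (Space d)))).coeFn_toLp] with x hx
  rw [Pi.sub_apply, testLp, hx]

lemma tendsto_testGrad_iff {φ : ℕ → 𝓓(U, ℝ)} {σ : L2Vec U} :
    Tendsto (fun n => testGrad (φ n)) atTop (𝓝 σ) ↔
      Tendsto (fun n => eLpNorm (fun x => gradient (φ n) x - σ x) 2
        (volume.restrict (U : Set (Space d)))) atTop (𝓝 0) := by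
  rw [Lp.tendsto_Lp_iff_tendsto_eLpNorm']
  refine tendsto_congr fun n => eLpNorm_congr_ae ?_
  filter_upwards [(memLp_gradient (φ n) (volume.restrict (U : Set (Space d)))).coeFn_toLp]
    with x hx
  rw [Pi.sub_apply, testGrad, hx]

lemma mem_H10_iff {u : L2 U} :
    u ∈ H10 U ↔ (∃ G, IsWeakGrad U u G) ∧ ∃ φ : ℕ → 𝓓(U, ℝ),
      Tendsto (fun n => testLp _ (φ n)) atTop (𝓝 u) ∧
      Tendsto (fun n => testGrad (φ n)) atTop (𝓝 (weakGrad U u)) := by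
  simp only [tendsto_testLp_iff, tendsto_testGrad_iff]
  rfl

lemma testLp_mem_H10 (φ : 𝓓(U, ℝ)) : testLp _ φ ∈ H10 U :=
  mem_H10_iff.2 ⟨⟨_, isWeakGrad_testLp φ⟩, fun _ => φ, tendsto_const_nhds, by
    simpa only [weakGrad_testLp] using tendsto_const_nhds⟩

lemma inner_weakGrad_le_of_forall_test {σ : L2Vec U} {c : ℝ}
    (hσ : ∀ φ : 𝓓(U, ℝ), |⟪σ, testGrad φ⟫_ℝ| ≤ c * ‖testGrad φ‖) {u : L2 U} (hu : u ∈ H10 U) :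
    |⟪σ, weakGrad U u⟫_ℝ| ≤ c * ‖weakGrad U u‖ := by
  obtain ⟨-, φ, -, hφ⟩ := mem_H10_iff.1 hu
  exact le_of_tendsto_of_tendsto' (tendsto_const_nhds.inner hφ).abs (hφ.norm.const_mul c)
    fun n => hσ (φ n)

end TestFunctions

section Poincare

variable {d : ℕ} {U : Opens (Space d)} {k : Fin d} {α β : ℝ}

lemma norm_testLp_le_of_slab (hαβ : α ≤ β) (hU : ∀ x ∈ U, x k ∈ Set.Icc α β) (φ : 𝓓(U, ℝ)) :
    ‖testLp (volume.restrict (U : Set (Space d))) φ‖ ≤ (β - α) * ‖testGrad φ‖ := by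
  refine norm_le_mul_norm_of_enorm_rpow_two_le (sub_nonneg.2 hαβ) ?_
  rw [enorm_testLp_rpow_two, enorm_testGrad_rpow_two]
  exact (setLIntegral_le_lintegral _ _).trans <|
    lintegral_enorm_rpow_le_of_slab one_le_two (φ.contDiff.of_le (by simp)) fun x hx =>
      test_eq_zero_of_notMem φ fun hxU => hx (hU x hxU)

lemma norm_le_norm_weakGrad_of_slab (hαβ : α ≤ β) (hU : ∀ x ∈ U, x k ∈ Set.Icc α β) {u : L2 U}
    (hu : u ∈ H10 U) : ‖u‖ ≤ (β - α) * ‖weakGrad U u‖ := by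
  obtain ⟨-, φ, hφ, hφ'⟩ := mem_H10_iff.1 hu
  exact le_of_tendsto_of_tendsto' hφ.norm (hφ'.norm.const_mul _) fun n =>
    norm_testLp_le_of_slab hαβ hU (φ n)

end Poincare

namespace BoxPartition

variable {d : ℕ} {a b : Fin d → ℝ}

lemma exists_interface_subset_biUnion_hyperplane (P : BoxPartition a b) :
    ∃ S : Finset (Fin d × ℝ), P.interface ⊆ ⋃ q ∈ S, {x | x q.1 = q.2} := by
  classical
  refine ⟨(Finset.univ.image fun j : Fin P.card × Fin d => (j.2, P.lower j.1 j.2)) ∪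
    Finset.univ.image fun j : Fin P.card × Fin d => (j.2, P.upper j.1 j.2), ?_⟩
  rintro x ⟨-, i, -, -, hx, -⟩
  obtain ⟨k, hk⟩ := Set.mem_iUnion.1 (frontier_openBox_subset _ _ hx)
  simp only [Set.mem_iUnion₂]
  rcases hk with hk | hk
  · exact ⟨(k, P.lower i k), by simp, hk⟩
  · exact ⟨(k, P.upper i k), by simp, hk⟩

lemma norm_testLp_surface_le (hab : ∀ k, a k ≤ b k) (P : BoxPartition a b)
    {S : Finset (Fin d × ℝ)} (hS : P.interface ⊆ ⋃ q ∈ S, {x | x q.1 = q.2})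
    (φ : 𝓓(openBox a b, ℝ)) :
    ‖testLp P.surface φ‖ ≤ √(∑ q ∈ S, (b q.1 - a q.1)) * ‖testGrad φ‖ := by
  have hlen : ∀ q ∈ S, 0 ≤ b q.1 - a q.1 := fun q _ => sub_nonneg.2 (hab q.1)
  refine norm_le_mul_norm_of_enorm_rpow_two_le (Real.sqrt_nonneg _) ?_
  rw [enorm_testLp_rpow_two, enorm_testGrad_rpow_two, ENNReal.ofReal_rpow_of_nonneg
    (Real.sqrt_nonneg _) zero_le_two, Real.rpow_two, Real.sq_sqrt (Finset.sum_nonneg hlen),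
    ENNReal.ofReal_sum_of_nonneg hlen]
  refine (lintegral_mono_set hS).trans ?_
  refine (setLIntegral_biUnion_hyperplane_enorm_rpow_le one_le_two (φ.contDiff.of_le (by simp))
    (fun x k hx => test_eq_zero_of_notMem φ fun hxU => hx ⟨(hxU k).1.le, (hxU k).2.le⟩) S).trans_eq
    ?_
  norm_num

lemma exists_norm_testLp_surface_le (hab : ∀ k, a k ≤ b k) (Γ : Set (Space d)) :
    ∃ K : ℝ, 0 ≤ K ∧ ∀ P : BoxPartition a b, P.interface = Γ → ∀ φ : 𝓓(openBox a b, ℝ),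
      ‖testLp P.surface φ‖ ≤ K * ‖testGrad φ‖ := by
  by_cases hΓ : ∃ S : Finset (Fin d × ℝ), Γ ⊆ ⋃ q ∈ S, {x | x q.1 = q.2}
  · obtain ⟨S, hS⟩ := hΓ
    exact ⟨_, Real.sqrt_nonneg _, fun P hP => P.norm_testLp_surface_le hab (hP.trans_subset hS)⟩
  · refine ⟨0, le_rfl, fun P hP => absurd ?_ hΓ⟩
    exact hP ▸ P.exists_interface_subset_biUnion_hyperplane

end BoxPartition

section Restriction

variable {d : ℕ} {U V : Opens (Space d)}

/-- The restriction map `L²(U) → L²(V)` for `V ⊆ U`. -/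
noncomputable def restrictL2 (hVU : V ≤ U) : L2 U →L[ℝ] L2 V :=
  Lp.LpToLpOfMeasureLeSMul ENNReal.one_ne_top
    ((Measure.restrict_mono hVU le_rfl).trans_eq (one_smul _ _).symm)

lemma coeFn_restrictL2 (hVU : V ≤ U) (f : L2 U) :
    restrictL2 hVU f =ᵐ[volume.restrict (V : Set (Space d))] f :=
  Lp.coeFn_LpToLpOfMeasureLeSMul _ _ f

lemma IsWeakDiv.restrict (hVU : V ≤ U) {σ : Space d → Space d} {f : L2 U}
    (h : IsWeakDiv U σ f) : IsWeakDiv V σ (restrictL2 hVU f) := by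
  intro φ
  let ψ : 𝓓(U, ℝ) := ⟨φ, φ.contDiff, φ.hasCompactSupport, φ.tsupport_subset.trans hVU⟩
  calc ∫ x in (V : Set (Space d)), ⟪σ x, gradient φ x⟫_ℝ
      = ∫ x in (U : Set (Space d)), ⟪σ x, gradient ψ x⟫_ℝ :=
        (setIntegral_eq_of_subset_of_forall_sdiff_eq_zero U.isOpen.measurableSet hVU fun x hx => by
          rw [gradient_test_eq_zero_of_notMem φ hx.2, inner_zero_right]).symm
    _ = -∫ x in (U : Set (Space d)), f x * ψ x := h ψ
    _ = -∫ x in (V : Set (Space d)), f x * φ x :=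
        congrArg Neg.neg (setIntegral_eq_of_subset_of_forall_sdiff_eq_zero
          U.isOpen.measurableSet hVU fun x hx =>
            mul_eq_zero_of_right _ (test_eq_zero_of_notMem φ hx.2))
    _ = -∫ x in (V : Set (Space d)), restrictL2 hVU f x * φ x := by
        congr 1
        refine integral_congr_ae ?_
        filter_upwards [coeFn_restrictL2 hVU f] with x hx
        rw [hx]

end Restriction

lemma convex_openBox {d : ℕ} (a b : Fin d → ℝ) : Convex ℝ (openBox a b : Set (Space d)) := by
  intro x hx y hy s t hs ht hst k
  simpa using convex_Ioo (a k) (b k) (hx k) (hy k) hs ht hst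

lemma openBox_nonempty {d : ℕ} {a b : Fin d → ℝ} (hab : ∀ k, a k < b k) :
    (openBox a b : Set (Space d)).Nonempty :=
  ⟨WithLp.toLp 2 fun k => (a k + b k) / 2, fun k =>
    ⟨left_lt_add_div_two.2 (hab k), add_div_two_lt_right.2 (hab k)⟩⟩

namespace BoxPartition

variable {d : ℕ} {a b : Fin d → ℝ} (P : BoxPartition a b)

lemma nonempty_fin_card (hab : ∀ k, a k < b k) : Nonempty (Fin P.card) := by
  obtain ⟨x, hx⟩ := openBox_nonempty hab
  have hx' := subset_closure hx
  rw [P.cover, Set.mem_iUnion] at hx'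
  exact ⟨hx'.choose⟩

section Cells

lemma cell_le (i : Fin P.card) : P.cell i ≤ openBox a b := P.subset i

lemma iUnion_cell_ae_eq :
    (⋃ i, (P.cell i : Set (Space d)) : Set (Space d)) =ᵐ[volume] (openBox a b : Set (Space d)) := by
  refine (Set.iUnion_subset P.subset).eventuallyLE.antisymm (ae_le_set.2 ?_)
  refine measure_mono_null (t := ⋃ i, frontier (P.cell i : Set (Space d))) ?_
    (measure_iUnion_null fun i => (convex_openBox _ _).addHaar_frontier _)
  rintro x ⟨hx, hx'⟩
  have hxcl := subset_closure hx
  rw [P.cover, Set.mem_iUnion] at hxcl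
  obtain ⟨i, hi⟩ := hxcl
  exact Set.mem_iUnion.2 ⟨i, hi, fun hint => hx' (Set.mem_iUnion.2 ⟨i, interior_subset hint⟩)⟩

lemma ae_restrict_iff_forall_cell {q : Space d → Prop} :
    (∀ᵐ x ∂(volume.restrict (openBox a b : Set (Space d))), q x) ↔
      ∀ i, ∀ᵐ x ∂(volume.restrict (P.cell i : Set (Space d))), q x := by
  rw [← Measure.restrict_congr_set P.iUnion_cell_ae_eq, ae_restrict_iUnion_iff]

lemma setIntegral_eq_sum_cell {E : Type*} [NormedAddCommGroup E] [NormedSpace ℝ E]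
    {f : Space d → E} (hf : IntegrableOn f (openBox a b)) :
    ∫ x in (openBox a b : Set (Space d)), f x =
      ∑ i, ∫ x in (P.cell i : Set (Space d)), f x := by
  rw [← setIntegral_congr_set P.iUnion_cell_ae_eq]
  exact integral_iUnion_fintype (fun i => (P.cell i).isOpen.measurableSet) P.disjoint
    fun i => hf.mono_set (P.subset i)

lemma sum_indicator_cell {E : Type*} [AddCommMonoid E] (F : Fin P.card → Space d → E)
    {i : Fin P.card} {x : Space d} (hx : x ∈ P.cell i) :
    ∑ j, (P.cell j : Set (Space d)).indicator (F j) x = F i x := by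
  rw [Fintype.sum_eq_single i, Set.indicator_of_mem hx]
  exact fun j hj =>
    Set.indicator_of_notMem (fun hxj => Set.disjoint_left.1 (P.disjoint j i hj) hxj hx) _

lemma eq_of_forall_restrictL2_eq {f g : L2 (openBox a b)}
    (h : ∀ i, restrictL2 (P.cell_le i) f = restrictL2 (P.cell_le i) g) : f = g := by
  refine Lp.ext (P.ae_restrict_iff_forall_cell.2 fun i => ?_)
  filter_upwards [coeFn_restrictL2 (P.cell_le i) f,
    coeFn_restrictL2 (P.cell_le i) g] with x hf hg
  rw [← hf, ← hg, h i]

lemma norm_sq_eq_sum_norm_sq_restrictL2 (f : L2 (openBox a b)) :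
    ‖f‖ ^ 2 = ∑ i, ‖restrictL2 (P.cell_le i) f‖ ^ 2 := by
  simp only [← real_inner_self_eq_norm_sq, L2.inner_def]
  rw [P.setIntegral_eq_sum_cell (f := fun x => ⟪f x, f x⟫_ℝ) (L2.integrable_inner f f)]
  refine Finset.sum_congr rfl fun i _ => integral_congr_ae ?_
  filter_upwards [coeFn_restrictL2 (P.cell_le i) f] with x hx
  rw [hx]

end Cells

section Flux

variable (p : Fin P.card → ℝ)

lemma coeff_eq {i : Fin P.card} {x : Space d} (hx : x ∈ P.cell i) : P.coeff p x = p i :=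
  P.sum_indicator_cell (fun i _ => p i) hx

lemma measurable_coeff : Measurable (P.coeff p) :=
  Finset.measurable_fun_sum _ fun i _ =>
    measurable_const.indicator (P.cell i).isOpen.measurableSet

lemma abs_coeff_le (x : Space d) : |P.coeff p x| ≤ ∑ i, |p i| :=
  (Finset.abs_sum_le_sum_abs _ _).trans <| Finset.sum_le_sum fun i _ =>
    norm_indicator_le_norm_self (fun _ => p i) x

lemma memLp_flux (u : L2 (openBox a b)) :
    MemLp (P.flux p u) 2 (volume.restrict (openBox a b : Set (Space d))) :=
  (Lp.memLp _).of_le_mul ((P.measurable_coeff p).aestronglyMeasurable.smul (Lp.memLp _).1) <|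
    ae_of_all _ fun x => by
      rw [flux, norm_smul]
      exact mul_le_mul_of_nonneg_right (P.abs_coeff_le p x) (norm_nonneg _)

lemma mul_norm_weakGrad_sq_le_inner_flux {m : ℝ} (hm : ∀ i, m ≤ p i) (u : L2 (openBox a b)) :
    m * ‖weakGrad _ u‖ ^ 2 ≤ ⟪(P.memLp_flux p u).toLp _, weakGrad _ u⟫_ℝ := by
  have hcoeff : ∀ᵐ x ∂(volume.restrict (openBox a b : Set (Space d))), m ≤ P.coeff p x := by
    refine P.ae_restrict_iff_forall_cell.2 fun i => ?_
    filter_upwards [ae_restrict_mem (P.cell i).isOpen.measurableSet] with x hx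
    rw [P.coeff_eq p hx]
    exact hm i
  rw [← real_inner_self_eq_norm_sq, L2.inner_def, L2.inner_def, ← integral_const_mul]
  refine integral_mono_ae ((L2.integrable_inner _ _).const_mul m) (L2.integrable_inner _ _) ?_
  filter_upwards [hcoeff, (P.memLp_flux p u).coeFn_toLp] with x hx hflux
  rw [hflux, flux, real_inner_smul_left]
  exact mul_le_mul_of_nonneg_right hx real_inner_self_nonneg

lemma iInf_pos (hab : ∀ k, a k < b k) {p : Fin P.card → ℝ} (hp : ∀ i, 0 < p i) :
    0 < ⨅ i, p i := by
  have := P.nonempty_fin_card hab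
  obtain ⟨i, hi⟩ := exists_eq_ciInf_of_finite (f := p)
  exact hi ▸ hp i

end Flux

section BrokenDiv

variable (σ : Space d → Space d)

lemma memLp_sum_indicator_weakDiv :
    MemLp (fun x => ∑ i, (P.cell i : Set (Space d)).indicator (weakDiv (P.cell i) σ) x) 2
      (volume.restrict (openBox a b : Set (Space d))) :=
  (memLp_finsetSum _ fun i _ => (memLp_indicator_iff_restrict
    (P.cell i).isOpen.measurableSet).2 (Lp.memLp (weakDiv (P.cell i) σ))).restrict _

/-- The piecewise weak divergence of a field with `σ|_{Ωᵢ} ∈ H(div, Ωᵢ)`, as an element of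
`L²(Ω)`. It is glued from the junk values `0` on the cells where `σ` has no weak divergence. -/
noncomputable def brokenDiv : L2 (openBox a b) :=
  (P.memLp_sum_indicator_weakDiv σ).toLp _

lemma restrictL2_brokenDiv (i : Fin P.card) :
    restrictL2 (P.cell_le i) (P.brokenDiv σ) = weakDiv (P.cell i) σ := by
  refine Lp.ext ?_
  filter_upwards [coeFn_restrictL2 (P.cell_le i) (P.brokenDiv σ),
    ae_cell_of_ae i (P.memLp_sum_indicator_weakDiv σ).coeFn_toLp,
    ae_restrict_mem (P.cell i).isOpen.measurableSet] with x hrestrict hbroken hx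
  rw [hrestrict, brokenDiv, hbroken, P.sum_indicator_cell (fun i => weakDiv (P.cell i) σ) hx]

lemma norm_sq_brokenDiv : ‖P.brokenDiv σ‖ ^ 2 = ∑ i, ‖weakDiv (P.cell i) σ‖ ^ 2 := by
  simp only [P.norm_sq_eq_sum_norm_sq_restrictL2, restrictL2_brokenDiv]

variable {σ}

lemma brokenDiv_eq {f : L2 (openBox a b)}
    (h : ∀ i, IsWeakDiv (P.cell i) σ (restrictL2 (P.cell_le i) f)) : P.brokenDiv σ = f :=
  P.eq_of_forall_restrictL2_eq fun i => by rw [restrictL2_brokenDiv, (h i).weakDiv_eq]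

lemma brokenDiv_eq_of_isWeakDiv {f : L2 (openBox a b)} (h : IsWeakDiv (openBox a b) σ f) :
    P.brokenDiv σ = f :=
  P.brokenDiv_eq fun i => h.restrict (P.cell_le i)

lemma sum_normalTrace_eq (hσ : MemLp σ 2 (volume.restrict (openBox a b : Set (Space d))))
    (φ : 𝓓(openBox a b, ℝ)) :
    ∑ i, normalTrace (P.cell i) σ φ =
      ⟪hσ.toLp σ, testGrad φ⟫_ℝ + ⟪P.brokenDiv σ, testLp _ φ⟫_ℝ := by
  have hgrad := integrable_inner' hσ (memLp_gradient φ _)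
  have hdiv := integrable_mul (Lp.memLp (P.brokenDiv σ)) (memLp_test φ _)
  rw [inner_toLp_testGrad, inner_testLp]
  refine Eq.trans ?_ ((P.setIntegral_eq_sum_cell (hgrad.add hdiv)).symm.trans
    (integral_add hgrad hdiv))
  refine Finset.sum_congr rfl fun i _ => integral_congr_ae ?_
  filter_upwards [coeFn_restrictL2 (P.cell_le i) (P.brokenDiv σ)] with x hx
  rw [Pi.add_apply, ← hx, restrictL2_brokenDiv]

lemma isJump_iff_inner (hσ : MemLp σ 2 (volume.restrict (openBox a b : Set (Space d))))
    {g : Lp ℝ 2 P.surface} :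
    P.IsJump σ g ↔ ∀ φ : 𝓓(openBox a b, ℝ),
      ⟪hσ.toLp σ, testGrad φ⟫_ℝ + ⟪P.brokenDiv σ, testLp _ φ⟫_ℝ = ⟪g, testLp _ φ⟫_ℝ := by
  simp only [IsJump, P.sum_normalTrace_eq hσ, inner_testLp g]

variable {P} in
lemma isJump_zero_of_isWeakDiv
    (hσ : MemLp σ 2 (volume.restrict (openBox a b : Set (Space d)))) {f : L2 (openBox a b)}
    (h : IsWeakDiv (openBox a b) σ f) : P.IsJump σ 0 :=
  (P.isJump_iff_inner hσ).2 fun φ => by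
    rw [P.brokenDiv_eq_of_isWeakDiv h, (isWeakDiv_iff_inner hσ).1 h φ, neg_add_cancel,
      inner_zero_left]

end BrokenDiv

section Jump

variable {P} {σ : Space d → Space d}

lemma eq_of_forall_inner_testLp_eq {g g' : Lp ℝ 2 P.surface}
    (h : ∀ φ : 𝓓(openBox a b, ℝ), ⟪g, testLp _ φ⟫_ℝ = ⟪g', testLp _ φ⟫_ℝ) : g = g' := by
  rw [← sub_eq_zero, Lp.eq_zero_iff_ae_eq_zero]
  have hzero : ∀ᵐ x ∂P.surface, x ∈ (openBox a b : Set (Space d)) → (g - g') x = 0 := by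
    refine (openBox a b).isOpen.ae_eq_zero_of_integral_contDiff_smul_eq_zero
      (((Lp.memLp (g - g')).locallyIntegrable one_le_two).locallyIntegrableOn _)
      fun φ hφ hcompact hsupp => ?_
    have hφ := inner_testLp (g - g') (⟨φ, hφ, hcompact, hsupp⟩ : 𝓓(openBox a b, ℝ))
    rw [inner_sub_left, h, sub_self] at hφ
    simp only [smul_eq_mul, mul_comm (φ _)]
    exact hφ.symm
  have hmem : ∀ᵐ x ∂P.surface, x ∈ (openBox a b : Set (Space d)) :=
    ae_mono (Measure.restrict_mono Set.inter_subset_left le_rfl)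
      (ae_restrict_mem (openBox a b).isOpen.measurableSet)
  filter_upwards [hzero, hmem] with x hx hxmem using hx hxmem

lemma IsJump.unique {g g' : Lp ℝ 2 P.surface} (h : P.IsJump σ g) (h' : P.IsJump σ g') :
    g = g' :=
  eq_of_forall_inner_testLp_eq fun φ => by rw [inner_testLp, inner_testLp, ← h φ, h' φ]

lemma IsJump.jump_eq {g : Lp ℝ 2 P.surface} (h : P.IsJump σ g) : P.jump σ = g := by
  have hex : ∃ g, P.IsJump σ g := ⟨g, h⟩
  rw [jump, dif_pos hex]
  exact hex.choose_spec.unique h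

end Jump

end BoxPartition

lemma norm_toLp_eq_lpNorm {α E : Type*} [MeasurableSpace α] {μ : Measure α}
    [NormedAddCommGroup E] {q : ℝ≥0∞} {f : α → E} (hf : MemLp f q μ) :
    ‖hf.toLp f‖ = lpNorm f q μ := by
  rw [Lp.norm_toLp, toReal_eLpNorm hf.1]

lemma isNorm_norm_comp {V E : Type*} [AddCommGroup V] [Module ℝ V] [NormedAddCommGroup E]
    [NormedSpace ℝ E] (T : V →ₗ[ℝ] E) (hT : ∀ u, ‖T u‖ = 0 → u = 0) :
    IsNorm fun u => ‖T u‖ := by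
  refine ⟨fun u v => ?_, fun c u => ?_, hT⟩
  · simp only [map_add]
    exact norm_add_le _ _
  · simp only [map_smul, norm_smul, Real.norm_eq_abs]

namespace BoxPartition

variable {d : ℕ} {a b : Fin d → ℝ} (P : BoxPartition a b) (p : Fin P.card → ℝ)

section ResidualMaps

/-- The gradient as a linear map on `𝕏ᵖ`. -/
noncomputable def gradMap : P.Xp p →ₗ[ℝ] L2Vec (openBox a b) where
  toFun u := weakGrad (openBox a b) u
  map_add' u v := ((weakGrad_spec u.2.1.1).add (weakGrad_spec v.2.1.1)).weakGrad_eq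
  map_smul' c u := ((weakGrad_spec u.2.1.1).smul c).weakGrad_eq

/-- The flux as a linear map on `𝕏ᵖ`. -/
noncomputable def fluxMap : P.Xp p →ₗ[ℝ] L2Vec (openBox a b) where
  toFun u := (P.memLp_flux p u).toLp _
  map_add' u v := ((MemLp.toLp_eq_toLp_iff _ _).2 (P.flux_add p u.2.1 v.2.1).symm).trans
    (MemLp.toLp_add (P.memLp_flux p u) (P.memLp_flux p v))
  map_smul' c u := ((MemLp.toLp_eq_toLp_iff _ _).2 (P.flux_smul p c u.2.1).symm).trans
    (MemLp.toLp_const_smul c (P.memLp_flux p u))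

/-- The piecewise divergence of the flux as a linear map on `𝕏ᵖ`. -/
noncomputable def divMap : P.Xp p →ₗ[ℝ] L2 (openBox a b) where
  toFun u := P.brokenDiv (P.flux p u)
  map_add' u v := P.brokenDiv_eq fun i => by
    simp only [map_add, restrictL2_brokenDiv]
    exact ((u.2.2.1 i).isWeakDiv.add (u.2.2.1 i).1 (v.2.2.1 i).1 (v.2.2.1 i).isWeakDiv).congr
      (ae_cell_of_ae i (P.flux_add p u.2.1 v.2.1))
  map_smul' c u := P.brokenDiv_eq fun i => by
    simp only [map_smul, restrictL2_brokenDiv]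
    exact ((u.2.2.1 i).isWeakDiv.smul c).congr (ae_cell_of_ae i (P.flux_smul p c u.2.1))

variable {P p}

lemma isJump_jumpFlux {u : L2 (openBox a b)} (hu : u ∈ P.Xp p) :
    P.IsJump (P.flux p u) (P.jumpFlux p u) := by
  obtain ⟨-, -, g, hg⟩ := hu
  rwa [jumpFlux, hg.jump_eq]

lemma isJump_iff_inner_maps {u : P.Xp p} {g : Lp ℝ 2 P.surface} :
    P.IsJump (P.flux p u) g ↔ ∀ φ : 𝓓(openBox a b, ℝ),
      ⟪P.fluxMap p u, testGrad φ⟫_ℝ + ⟪P.divMap p u, testLp _ φ⟫_ℝ = ⟪g, testLp _ φ⟫_ℝ :=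
  P.isJump_iff_inner (P.memLp_flux p u)

variable (P p)

/-- The jump of the flux as a linear map on `𝕏ᵖ`. -/
noncomputable def jumpMap : P.Xp p →ₗ[ℝ] Lp ℝ 2 P.surface where
  toFun u := P.jumpFlux p u
  map_add' u v := (isJump_iff_inner_maps.2 fun φ => by
    simp only [map_add, inner_add_left, ← isJump_iff_inner_maps.1 (isJump_jumpFlux u.2) φ,
      ← isJump_iff_inner_maps.1 (isJump_jumpFlux v.2) φ]
    ring : P.IsJump (P.flux p ↑(u + v)) _).jump_eq
  map_smul' c u := (isJump_iff_inner_maps.2 fun φ => by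
    simp only [map_smul, real_inner_smul_left, RingHom.id_apply,
      ← isJump_iff_inner_maps.1 (isJump_jumpFlux u.2) φ]
    ring : P.IsJump (P.flux p ↑(c • u)) _).jump_eq

/-- The residuals `(div(p∇u), √Θ [p∇u · n])` as a linear map into a Hilbert space, whose norm is
the residual norm. -/
noncomputable def resMap (Θ : ℝ) :
    P.Xp p →ₗ[ℝ] WithLp 2 (L2 (openBox a b) × Lp ℝ 2 P.surface) :=
  (WithLp.linearEquiv 2 ℝ _).symm.toLinearMap ∘ₗ (P.divMap p).prod (√Θ • P.jumpMap p)

/-- The gradient and the residuals as a linear map into a Hilbert space, whose norm is the graph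
norm. -/
noncomputable def graphMap : P.Xp p →ₗ[ℝ]
    WithLp 2 (L2Vec (openBox a b) × WithLp 2 (L2 (openBox a b) × Lp ℝ 2 P.surface)) :=
  (WithLp.linearEquiv 2 ℝ _).symm.toLinearMap ∘ₗ (P.gradMap p).prod (P.resMap p 1)

end ResidualMaps

section Norms

variable {P p} {Θ : ℝ}

lemma resNorm_nonneg (u : L2 (openBox a b)) : 0 ≤ P.resNorm p Θ u := Real.sqrt_nonneg _

lemma graphNorm_nonneg (u : L2 (openBox a b)) : 0 ≤ P.graphNorm p u := Real.sqrt_nonneg _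

lemma lpNorm_divFlux (u : L2 (openBox a b)) :
    lpNorm (P.divFlux p u) 2 (volume.restrict (openBox a b : Set (Space d))) =
      ‖P.brokenDiv (P.flux p u)‖ :=
  (norm_toLp_eq_lpNorm (P.memLp_sum_indicator_weakDiv _)).symm

lemma lpNorm_divFlux_add (u f : L2 (openBox a b)) :
    lpNorm (fun x => P.divFlux p u x + f x) 2 (volume.restrict (openBox a b : Set (Space d))) =
      ‖P.brokenDiv (P.flux p u) + f‖ := by
  have hdiv := P.memLp_sum_indicator_weakDiv (P.flux p u)
  refine (norm_toLp_eq_lpNorm (hdiv.add (Lp.memLp f))).symm.trans ?_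
  rw [MemLp.toLp_add hdiv (Lp.memLp f), Lp.toLp_coeFn]
  rfl

lemma resNorm_sq (hΘ : 0 ≤ Θ) (u : L2 (openBox a b)) :
    P.resNorm p Θ u ^ 2 = ‖P.brokenDiv (P.flux p u)‖ ^ 2 + Θ * ‖P.jumpFlux p u‖ ^ 2 := by
  rw [resNorm, Real.sq_sqrt (by positivity), lpNorm_divFlux]

lemma graphNorm_sq (u : L2 (openBox a b)) :
    P.graphNorm p u ^ 2 =
      P.normH10 u ^ 2 + ‖P.brokenDiv (P.flux p u)‖ ^ 2 + ‖P.jumpFlux p u‖ ^ 2 := by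
  rw [graphNorm, Real.sq_sqrt (by positivity), P.norm_sq_brokenDiv]

lemma norm_resMap (hΘ : 0 ≤ Θ) (u : P.Xp p) : ‖P.resMap p Θ u‖ = P.resNorm p Θ u := by
  refine (pow_left_inj₀ (norm_nonneg _) (resNorm_nonneg _) two_ne_zero).1 ?_
  rw [resNorm_sq hΘ, WithLp.prod_norm_sq_eq_of_L2]
  change _ + ‖√Θ • P.jumpFlux p u‖ ^ 2 = _
  rw [norm_smul, mul_pow, Real.norm_eq_abs, sq_abs, Real.sq_sqrt hΘ]
  rfl

lemma norm_graphMap (u : P.Xp p) : ‖P.graphMap p u‖ = P.graphNorm p u := by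
  refine (pow_left_inj₀ (norm_nonneg _) (graphNorm_nonneg _) two_ne_zero).1 ?_
  rw [graphNorm_sq, WithLp.prod_norm_sq_eq_of_L2, add_assoc]
  change _ + ‖P.resMap p 1 u‖ ^ 2 = _
  rw [norm_resMap zero_le_one, resNorm_sq zero_le_one, one_mul]
  rfl

lemma isNorm_resNorm (hΘ : 0 ≤ Θ) (h : ∀ u ∈ P.Xp p, P.resNorm p Θ u = 0 → u = 0) :
    IsNorm fun u : P.Xp p => P.resNorm p Θ u := by
  simp only [← norm_resMap hΘ]
  exact isNorm_norm_comp _ fun u hu => Subtype.ext (h u u.2 (norm_resMap hΘ u ▸ hu))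

lemma isNorm_graphNorm (h : ∀ u ∈ P.Xp p, P.graphNorm p u = 0 → u = 0) :
    IsNorm fun u : P.Xp p => P.graphNorm p u := by
  simp only [← norm_graphMap]
  exact isNorm_norm_comp _ fun u hu => Subtype.ext (h u u.2 (norm_graphMap u ▸ hu))

lemma normH10_le_graphNorm (u : L2 (openBox a b)) : P.normH10 u ≤ P.graphNorm p u := by
  refine le_of_sq_le_sq ?_ (graphNorm_nonneg _)
  rw [graphNorm_sq, add_assoc]
  exact le_add_of_nonneg_right (by positivity)

lemma norm_brokenDiv_le_resNorm (hΘ : 0 ≤ Θ) (u : L2 (openBox a b)) :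
    ‖P.brokenDiv (P.flux p u)‖ ≤ P.resNorm p Θ u := by
  refine le_of_sq_le_sq ?_ (resNorm_nonneg _)
  rw [resNorm_sq hΘ]
  exact le_add_of_nonneg_right (by positivity)

lemma sqrt_mul_norm_jumpFlux_le_resNorm (hΘ : 0 ≤ Θ) (u : L2 (openBox a b)) :
    √Θ * ‖P.jumpFlux p u‖ ≤ P.resNorm p Θ u := by
  refine le_of_sq_le_sq ?_ (resNorm_nonneg _)
  rw [resNorm_sq hΘ, mul_pow, Real.sq_sqrt hΘ]
  exact le_add_of_nonneg_left (by positivity)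

lemma resNorm_le_sqrt_mul_graphNorm (hΘ : 0 ≤ Θ) (u : L2 (openBox a b)) :
    P.resNorm p Θ u ≤ √(1 + Θ) * P.graphNorm p u := by
  refine le_of_sq_le_sq ?_ (mul_nonneg (Real.sqrt_nonneg _) (graphNorm_nonneg _))
  rw [mul_pow, Real.sq_sqrt (by positivity), resNorm_sq hΘ, graphNorm_sq]
  linarith [sq_nonneg (P.normH10 u), sq_nonneg ‖P.jumpFlux p u‖,
    mul_nonneg hΘ (sq_nonneg (P.normH10 u)),
    mul_nonneg hΘ (sq_nonneg ‖P.brokenDiv (P.flux p u)‖)]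

lemma graphNorm_le_sqrt_mul_resNorm (hΘ : 0 < Θ) {K : ℝ} {u : L2 (openBox a b)}
    (hK : P.normH10 u ≤ K * P.resNorm p Θ u) :
    P.graphNorm p u ≤ √(K ^ 2 + 1 + Θ⁻¹) * P.resNorm p Θ u := by
  have hgrad : P.normH10 u ^ 2 ≤ K ^ 2 * P.resNorm p Θ u ^ 2 := by
    rw [← mul_pow]
    exact pow_le_pow_left₀ (norm_nonneg _) hK 2
  have hdiv : ‖P.brokenDiv (P.flux p u)‖ ^ 2 ≤ P.resNorm p Θ u ^ 2 :=
    pow_le_pow_left₀ (norm_nonneg _) (norm_brokenDiv_le_resNorm hΘ.le u) 2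
  have hjump : ‖P.jumpFlux p u‖ ^ 2 ≤ Θ⁻¹ * P.resNorm p Θ u ^ 2 := by
    rw [le_inv_mul_iff₀ hΘ, resNorm_sq hΘ.le]
    exact le_add_of_nonneg_left (sq_nonneg _)
  refine le_of_sq_le_sq ?_ (mul_nonneg (Real.sqrt_nonneg _) (resNorm_nonneg _))
  rw [mul_pow, Real.sq_sqrt (by positivity), graphNorm_sq]
  linarith

lemma exists_graphNorm_equiv_resNorm (hΘ : 0 < Θ) {K : ℝ}
    (hK : ∀ u ∈ P.Xp p, P.normH10 u ≤ K * P.resNorm p Θ u) :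
    ∃ c₁ c₂ : ℝ, 0 < c₁ ∧ 0 < c₂ ∧ ∀ u ∈ P.Xp p,
      c₁ * P.graphNorm p u ≤ P.resNorm p Θ u ∧ P.resNorm p Θ u ≤ c₂ * P.graphNorm p u :=
  have hpos : 0 < √(K ^ 2 + 1 + Θ⁻¹) := by positivity
  ⟨(√(K ^ 2 + 1 + Θ⁻¹))⁻¹, √(1 + Θ), inv_pos.2 hpos, by positivity, fun u hu =>
    ⟨(inv_mul_le_iff₀ hpos).2 (graphNorm_le_sqrt_mul_resNorm hΘ (hK u hu)),
      resNorm_le_sqrt_mul_graphNorm hΘ.le u⟩⟩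

end Norms

section Estimate

variable {P p}

lemma abs_inner_fluxMap_testGrad_le {K K' : ℝ} {φ : 𝓓(openBox a b, ℝ)}
    (hK : ‖testLp (volume.restrict (openBox a b : Set (Space d))) φ‖ ≤ K * ‖testGrad φ‖)
    (hK' : ‖testLp P.surface φ‖ ≤ K' * ‖testGrad φ‖) (u : P.Xp p) :
    |⟪P.fluxMap p u, testGrad φ⟫_ℝ| ≤
      (K * ‖P.divMap p u‖ + K' * ‖P.jumpMap p u‖) * ‖testGrad φ‖ := by
  have hgreen : ⟪P.fluxMap p u, testGrad φ⟫_ℝ =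
      ⟪P.jumpMap p u, testLp _ φ⟫_ℝ - ⟪P.divMap p u, testLp _ φ⟫_ℝ :=
    eq_sub_of_add_eq (isJump_iff_inner_maps.1 (isJump_jumpFlux u.2) φ)
  calc |⟪P.fluxMap p u, testGrad φ⟫_ℝ|
      ≤ |⟪P.jumpMap p u, testLp _ φ⟫_ℝ| + |⟪P.divMap p u, testLp _ φ⟫_ℝ| :=
        hgreen ▸ abs_sub _ _
    _ ≤ ‖P.jumpMap p u‖ * (K' * ‖testGrad φ‖) + ‖P.divMap p u‖ * (K * ‖testGrad φ‖) :=
        add_le_add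
          ((abs_real_inner_le_norm _ _).trans (mul_le_mul_of_nonneg_left hK' (norm_nonneg _)))
          ((abs_real_inner_le_norm _ _).trans (mul_le_mul_of_nonneg_left hK (norm_nonneg _)))
    _ = _ := by ring

lemma mul_normH10_le {K K' m : ℝ} (hK₀ : 0 ≤ K) (hK₀' : 0 ≤ K')
    (hK : ∀ φ : 𝓓(openBox a b, ℝ),
      ‖testLp (volume.restrict (openBox a b : Set (Space d))) φ‖ ≤ K * ‖testGrad φ‖)
    (hK' : ∀ φ : 𝓓(openBox a b, ℝ), ‖testLp P.surface φ‖ ≤ K' * ‖testGrad φ‖)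
    (hm : ∀ i, m ≤ p i) (u : P.Xp p) :
    m * P.normH10 u ≤ K * ‖P.divMap p u‖ + K' * ‖P.jumpMap p u‖ := by
  have henergy : m * P.normH10 u ^ 2 ≤
      (K * ‖P.divMap p u‖ + K' * ‖P.jumpMap p u‖) * P.normH10 u :=
    (P.mul_norm_weakGrad_sq_le_inner_flux p hm u).trans <| (le_abs_self _).trans <|
      inner_weakGrad_le_of_forall_test
        (fun φ => abs_inner_fluxMap_testGrad_le (hK φ) (hK' φ) u) u.2.1
  have hnonneg : 0 ≤ P.normH10 (u : L2 (openBox a b)) := norm_nonneg _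
  rcases hnonneg.eq_or_lt with h | h
  · rw [← h, mul_zero]
    positivity
  · exact le_of_mul_le_mul_right (by rwa [mul_assoc, ← sq]) h

lemma exists_normH10_le (hd : 0 < d) (hab : ∀ k, a k < b k) (Γ : Set (Space d)) {Θ : ℝ}
    (hΘ : 0 < Θ) :
    ∃ C : ℝ, 0 < C ∧ ∀ P : BoxPartition a b, P.interface = Γ → ∀ p : Fin P.card → ℝ,
      (∀ i, 0 < p i) → ∀ u ∈ P.Xp p, P.normH10 u ≤ C / (⨅ i, p i) * P.resNorm p Θ u := by
  let k : Fin d := ⟨0, hd⟩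
  obtain ⟨K', hK₀', hK'⟩ := exists_norm_testLp_surface_le (fun k => (hab k).le) Γ
  have hK₀ : 0 < b k - a k := sub_pos.2 (hab k)
  refine ⟨b k - a k + K' / √Θ, by positivity, fun P hP p hp u hu => ?_⟩
  rw [div_mul_eq_mul_div, le_div_iff₀' (P.iInf_pos hab hp)]
  calc (⨅ i, p i) * P.normH10 u
      ≤ (b k - a k) * ‖P.brokenDiv (P.flux p u)‖ + K' * ‖P.jumpFlux p u‖ :=
        mul_normH10_le hK₀.le hK₀'
          (norm_testLp_le_of_slab (hab k).le fun x hx => ⟨(hx k).1.le, (hx k).2.le⟩) (hK' P hP)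
          (ciInf_le (Set.finite_range p).bddBelow) ⟨u, hu⟩
    _ = (b k - a k) * ‖P.brokenDiv (P.flux p u)‖ + K' / √Θ * (√Θ * ‖P.jumpFlux p u‖) := by
        field_simp
    _ ≤ (b k - a k) * P.resNorm p Θ u + K' / √Θ * P.resNorm p Θ u := by
        gcongr
        · exact norm_brokenDiv_le_resNorm hΘ.le u
        · exact sqrt_mul_norm_jumpFlux_le_resNorm hΘ.le u
    _ = _ := by ring

lemma eq_zero_of_normH10_eq_zero (hd : 0 < d) (hab : ∀ k, a k ≤ b k) {u : L2 (openBox a b)}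
    (hu : u ∈ H10 (openBox a b)) (h : P.normH10 u = 0) : u = 0 := by
  have hpoincare := norm_le_norm_weakGrad_of_slab (hab ⟨0, hd⟩)
    (fun x hx => ⟨(hx _).1.le, (hx _).2.le⟩) hu
  rw [show ‖weakGrad (openBox a b) u‖ = 0 from h, mul_zero] at hpoincare
  exact norm_le_zero_iff.1 hpoincare

end Estimate

namespace IsWeakSolution

variable {P p} {ℓ w : L2 (openBox a b)}

lemma isWeakDiv (h : P.IsWeakSolution p ℓ w) : IsWeakDiv (openBox a b) (P.flux p w) (-ℓ) := by
  refine (isWeakDiv_iff_inner (P.memLp_flux p w)).2 fun φ => ?_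
  have htest := h.2 _ (testLp_mem_H10 φ)
  rw [weakGrad_testLp, ← inner_toLp_left (P.memLp_flux p w)] at htest
  rw [htest, inner_neg_left, neg_neg, real_inner_comm, L2.inner_def]
  rfl

lemma brokenDiv_flux (h : P.IsWeakSolution p ℓ w) : P.brokenDiv (P.flux p w) = -ℓ :=
  P.brokenDiv_eq_of_isWeakDiv h.isWeakDiv

lemma isJump (h : P.IsWeakSolution p ℓ w) : P.IsJump (P.flux p w) 0 :=
  isJump_zero_of_isWeakDiv (P.memLp_flux p w) h.isWeakDiv

lemma mem_Xp (h : P.IsWeakSolution p ℓ w) : w ∈ P.Xp p :=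
  ⟨h.1, fun i => ⟨(P.memLp_flux p w).mono_measure (Measure.restrict_mono (P.subset i) le_rfl),
    _, h.isWeakDiv.restrict (P.cell_le i)⟩, 0, h.isJump⟩

lemma brokenDiv_flux_sub (h : P.IsWeakSolution p ℓ w) {u : L2 (openBox a b)} (hu : u ∈ P.Xp p) :
    P.brokenDiv (P.flux p (u - w)) = P.brokenDiv (P.flux p u) + ℓ := by
  rw [← sub_neg_eq_add, ← h.brokenDiv_flux]
  exact (P.divMap p).map_sub ⟨u, hu⟩ ⟨w, h.mem_Xp⟩

lemma jumpFlux_sub (h : P.IsWeakSolution p ℓ w) {u : L2 (openBox a b)} (hu : u ∈ P.Xp p) :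
    P.jumpFlux p (u - w) = P.jumpFlux p u := by
  have hw : P.jumpFlux p w = 0 := h.isJump.jump_eq
  rw [← sub_zero (P.jumpFlux p u), ← hw]
  exact (P.jumpMap p).map_sub ⟨u, hu⟩ ⟨w, h.mem_Xp⟩

lemma resNorm_sub (h : P.IsWeakSolution p ℓ w) {u : L2 (openBox a b)} (hu : u ∈ P.Xp p) (Θ : ℝ) :
    P.resNorm p Θ (u - w) =
      √((lpNorm (fun x => P.divFlux p u x + ℓ x) 2
          (volume.restrict (openBox a b : Set (Space d)))) ^ 2
        + Θ * ‖P.jumpFlux p u‖ ^ 2) := by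
  rw [resNorm, lpNorm_divFlux, h.brokenDiv_flux_sub hu, h.jumpFlux_sub hu, lpNorm_divFlux_add]

end IsWeakSolution

end BoxPartition

end Transmission

theorem mainTheorem1 {d : ℕ} (hd : 0 < d) (a b : Fin d → ℝ) (hab : ∀ k, a k < b k)
    (Γ : Set (Transmission.Space d)) (Θ : ℝ) (hΘ : 0 < Θ) :
    ∃ C : ℝ, 0 < C ∧
      ∀ P : Transmission.BoxPartition a b, P.interface = Γ →
      ∀ p : Fin P.card → ℝ, (∀ i, 0 < p i) →
        -- the residuals control the `H¹₀` norm on `𝕏ᵖ`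
        (∀ u ∈ P.Xp p, P.normH10 u ≤ C / (⨅ i, p i) *
          √((lpNorm (P.divFlux p u) 2
              (volume.restrict (Transmission.openBox a b : Set (Transmission.Space d)))) ^ 2
            + Θ * ‖P.jumpFlux p u‖ ^ 2)) ∧
        -- the residual norm is a norm on `𝕏ᵖ`, equivalent to the graph norm
        Transmission.IsNorm (fun u : P.Xp p => P.resNorm p Θ u) ∧
        Transmission.IsNorm (fun u : P.Xp p => P.graphNorm p u) ∧
        (∃ c₁ c₂ : ℝ, 0 < c₁ ∧ 0 < c₂ ∧ ∀ u ∈ P.Xp p,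
          c₁ * P.graphNorm p u ≤ P.resNorm p Θ u ∧ P.resNorm p Θ u ≤ c₂ * P.graphNorm p u) ∧
        -- error estimate for the transmission problem with source `ℓ` and weak solution `w`
        (∀ ℓ w : Transmission.L2 (Transmission.openBox a b), P.IsWeakSolution p ℓ w →
          w ∈ P.Xp p ∧ ∀ u ∈ P.Xp p,
            P.normH10 (u - w) ≤ C / (⨅ i, p i) * P.resNorm p Θ (u - w) ∧
            P.resNorm p Θ (u - w) =
              √((lpNorm (fun x => P.divFlux p u x + ℓ x) 2
                  (volume.restrict (Transmission.openBox a b : Set (Transmission.Space d)))) ^ 2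
                + Θ * ‖P.jumpFlux p u‖ ^ 2)) := by
  obtain ⟨C, hC, hestimate⟩ := Transmission.BoxPartition.exists_normH10_le hd hab Γ hΘ
  refine ⟨C, hC, fun P hP p hp => ?_⟩
  have hle := hestimate P hP p hp
  have hdefinite : ∀ u ∈ P.Xp p, P.normH10 u ≤ 0 → u = 0 := fun u hu h =>
    Transmission.BoxPartition.eq_zero_of_normH10_eq_zero hd (fun k => (hab k).le) hu.1
      (h.antisymm (norm_nonneg _))
  refine ⟨hle,
    Transmission.BoxPartition.isNorm_resNorm hΘ.le fun u hu h => hdefinite u hu ?_,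
    Transmission.BoxPartition.isNorm_graphNorm fun u hu h => hdefinite u hu ?_,
    Transmission.BoxPartition.exists_graphNorm_equiv_resNorm hΘ hle,
    fun ℓ w hw => ⟨hw.mem_Xp, fun u hu =>
      ⟨hle _ (Submodule.sub_mem _ hu hw.mem_Xp), hw.resNorm_sub hu Θ⟩⟩⟩
  · simpa [h] using hle u hu
  · exact (Transmission.BoxPartition.normH10_le_graphNorm u).trans_eq h
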